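/- Let $K$ be any field, let $n\ge 6$ and $S=K[x_1,\dots,x_n]$ with the standard grading and graded maximal ideal $\mathfrak m=(x_1,\dots,x_n)$. For a monomial ideal $I\subset S$ let $\mathcal G(I)$ be its minimal set of monomial generators. The ideal $I$ is fully-supported if every variable $x_i$ divides some element of $\mathcal G(I)$, and it has linear quotients if $\mathcal G(I)$ can be ordered as $u_1,\dots,u_m$ so that each colon ideal $(u_1,\dots,u_{j-1}):(u_j)$, $2\le j\le m$, is generated by variables. For a graded ideal $I\subset S$ put $\operatorname{reg} I=\max\{i+j : H^i_{\mathfrak m}(I)_j\neq 0\}$, and say that $I$ has a linear resolution if, for some $q$, it has a graded free resolution of the form $\cdots\to S(-q-2)^{b_2}\to S(-q-1)^{b_1}\to S(-q)^{b_0}\to I\to 0$. Theorem. For each integer $d$ with $3\le d\le n-3$, there exists a fully-supported squarefree monomial ideal $I\subset S$, generated in degree $d$, such that $I$ has linear quotients and $\operatorname{reg} I^2=2d+1$. Hence, $I^2$ does not have a linear resolution. -/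

import Mathlib

noncomputable section

namespace MonomialIdeals

/-! ### Monomial ideals in the polynomial ring `K[x_1, …, x_n]` -/

section Monomial

variable {K : Type*} [Field K] {n : ℕ}

/-- `I` is generated by monomials. -/
def IsMonomialIdeal (I : Ideal (MvPolynomial (Fin n) K)) : Prop :=
  ∃ s : Set (Fin n →₀ ℕ), I = Ideal.span ((fun u => MvPolynomial.monomial u (1 : K)) '' s)

/-- The exponent vectors of the minimal monomial generators of a monomial ideal `I`: the monomials
in `I` that are minimal for divisibility. -/
def minGens (I : Ideal (MvPolynomial (Fin n) K)) : Set (Fin n →₀ ℕ) :=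
  {u | Minimal (fun v => MvPolynomial.monomial v (1 : K) ∈ I) u}

/-- `I` is a squarefree monomial ideal. -/
def IsSquarefreeMonomialIdeal (I : Ideal (MvPolynomial (Fin n) K)) : Prop :=
  IsMonomialIdeal I ∧ ∀ u ∈ minGens I, ∀ i, u i ≤ 1

/-- All minimal monomial generators of `I` have degree `d`. -/
def GeneratedInDegree (I : Ideal (MvPolynomial (Fin n) K)) (d : ℕ) : Prop :=
  ∀ u ∈ minGens I, u.degree = d

/-- The support of a monomial ideal: the indices of the variables dividing some minimal
monomial generator. -/
def supp (I : Ideal (MvPolynomial (Fin n) K)) : Set (Fin n) :=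
  ⋃ u ∈ minGens I, {i | u i ≠ 0}

/-- Every variable divides some minimal monomial generator. -/
def IsFullySupported (I : Ideal (MvPolynomial (Fin n) K)) : Prop :=
  supp I = Set.univ

/-- There is an order `u_0, …, u_{m-1}` of the minimal monomial generators of `I` such that each
colon ideal `(u_0, …, u_{j-1}) : (u_j)` is generated by variables. (For `j = 0` this colon ideal is
zero, generated by the empty set of variables.) -/
def HasLinearQuotients (I : Ideal (MvPolynomial (Fin n) K)) : Prop :=
  ∃ (m : ℕ) (u : Fin m → (Fin n →₀ ℕ)), Function.Injective u ∧ Set.range u = minGens I ∧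
    ∀ j : Fin m, ∃ T : Set (Fin n),
      (Ideal.span ((fun k => MvPolynomial.monomial (u k) (1 : K)) '' {k | k < j})).colon
          {MvPolynomial.monomial (u j) (1 : K)} =
        Ideal.span ((fun i => (MvPolynomial.X i : MvPolynomial (Fin n) K)) '' T)

end Monomial

/-! ### Linear resolutions -/

section LinearResolution

variable {K : Type*} [Field K] {n : ℕ}

/-- `I` has a `q`-linear resolution: there is a graded free resolution
`⋯ → S(-q-2)^{b_2} → S(-q-1)^{b_1} → S(-q)^{b_0} → I → 0` with `S = K[x_1, …, x_n]`. The augmentation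
sends basis elements to forms of degree `q` and the other maps are given by matrices of linear
forms; in particular, the resolution is minimal. -/
def HasLinearResolutionOfDegree (I : Ideal (MvPolynomial (Fin n) K)) (q : ℕ) : Prop :=
  ∃ (b : ℕ → ℕ)
    (ε : (Fin (b 0) → MvPolynomial (Fin n) K) →ₗ[MvPolynomial (Fin n) K] MvPolynomial (Fin n) K)
    (φ : ∀ i : ℕ, (Fin (b (i + 1)) → MvPolynomial (Fin n) K) →ₗ[MvPolynomial (Fin n) K]
      (Fin (b i) → MvPolynomial (Fin n) K)),
    (∀ k, (ε (Pi.single k 1)).IsHomogeneous q) ∧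
    (∀ i k l, (φ i (Pi.single k 1) l).IsHomogeneous 1) ∧
    LinearMap.range ε = I ∧
    Function.Exact (φ 0) ε ∧
    ∀ i, Function.Exact (φ (i + 1)) (φ i)

/-- `I` has a linear resolution. -/
def HasLinearResolution (I : Ideal (MvPolynomial (Fin n) K)) : Prop :=
  ∃ q, HasLinearResolutionOfDegree I q

end LinearResolution

/-! ### Graded local cohomology and Castelnuovo–Mumford regularity

The local cohomology `H^i_𝔪(I)` with respect to `𝔪 = (x_1, …, x_n)` is the cohomology of the Čech
complex on `x_1, …, x_n`, with terms `C^i = ⨁_{|A| = i} I_{x_A}`, where `x_A = ∏_{a ∈ A} x_a`. All the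
localizations `I_{x_A}` are realized inside the ring of Laurent polynomials, and the graded pieces
are taken with respect to the total degree. -/

section Regularity

/-- The Laurent polynomial ring `K[x_1^{±1}, …, x_n^{±1}]`. -/
abbrev Laurent (K : Type*) [Field K] (n : ℕ) : Type _ := AddMonoidAlgebra K (Fin n → ℤ)

/-- The inclusion of the polynomial ring into the Laurent polynomial ring. -/
def toLaurent (K : Type*) [Field K] (n : ℕ) : MvPolynomial (Fin n) K →ₐ[K] Laurent K n :=
  MvPolynomial.aeval (fun i => AddMonoidAlgebra.single (Pi.single i 1) 1)

variable {K : Type*} [Field K] {n : ℕ}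

/-- The localization `I_{x_A}`, as the set of the Laurent polynomials `f` such that
`x_A ^ k * f ∈ I` for some `k`. -/
def localizedIdeal (I : Ideal (MvPolynomial (Fin n) K)) (A : Finset (Fin n)) :
    Submodule K (Laurent K n) where
  carrier := {f | ∃ k : ℕ, ∃ p ∈ I,
    toLaurent K n (∏ a ∈ A, MvPolynomial.X a) ^ k * f = toLaurent K n p}
  zero_mem' := ⟨0, 0, I.zero_mem, by simp⟩
  add_mem' := by
    rintro f g ⟨k, p, hp, hf⟩ ⟨l, q, hq, hg⟩
    refine ⟨k + l, (∏ a ∈ A, MvPolynomial.X a) ^ l * p + (∏ a ∈ A, MvPolynomial.X a) ^ k * q,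
      I.add_mem (I.mul_mem_left _ hp) (I.mul_mem_left _ hq), ?_⟩
    rw [map_add, map_mul, map_mul, map_pow, map_pow, ← hf, ← hg]
    ring
  smul_mem' := by
    rintro c f ⟨k, p, hp, hf⟩
    refine ⟨k, c • p, I.smul_of_tower_mem c hp, ?_⟩
    rw [map_smul, ← hf, mul_smul_comm]

/-- The Laurent polynomials that are homogeneous of total degree `j`. -/
def homogeneousLaurent (K : Type*) [Field K] (n : ℕ) (j : ℤ) : Submodule K (Laurent K n) :=
  AddMonoidAlgebra.gradeBy K (fun e : Fin n → ℤ => ∑ a, e a) j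

/-- The degree `j` part of the `i`-th term `⨁_{|A| = i} I_{x_A}` of the Čech complex of `I`; its
elements are families indexed by all `A`, vanishing unless `|A| = i`. -/
def cechCochains (I : Ideal (MvPolynomial (Fin n) K)) (i j : ℤ) :
    Submodule K (Finset (Fin n) → Laurent K n) :=
  Submodule.pi Set.univ fun A =>
    if (A.card : ℤ) = i then localizedIdeal I A ⊓ homogeneousLaurent K n j else ⊥

/-- The Čech differential `(δ c)_A = ∑_{a ∈ A} (-1)^{#{b ∈ A | b < a}} c_{A \ {a}}`. -/
def cechDiff (K : Type*) [Field K] (n : ℕ) :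
    (Finset (Fin n) → Laurent K n) →ₗ[K] (Finset (Fin n) → Laurent K n) where
  toFun c A := ∑ a ∈ A, (-1 : ℤ) ^ (A.filter (fun b => b < a)).card • c (A.erase a)
  map_add' c c' := by
    funext A
    simp [smul_add, Finset.sum_add_distrib]
  map_smul' r c := by
    funext A
    simp only [Pi.smul_apply, RingHom.id_apply, Finset.smul_sum]
    exact Finset.sum_congr rfl fun a _ => smul_comm _ _ _

/-- The degree `j` part of the `i`-cocycles of the Čech complex of `I`. -/
def cechCocycles (I : Ideal (MvPolynomial (Fin n) K)) (i j : ℤ) :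
    Submodule K (Finset (Fin n) → Laurent K n) :=
  cechCochains I i j ⊓ LinearMap.ker (cechDiff K n)

/-- The degree `j` part of the `i`-coboundaries of the Čech complex of `I`. -/
def cechCoboundaries (I : Ideal (MvPolynomial (Fin n) K)) (i j : ℤ) :
    Submodule K (Finset (Fin n) → Laurent K n) :=
  (cechCochains I (i - 1) j).map (cechDiff K n)

/-- The graded piece `H^i_𝔪(I)_j` of the `i`-th local cohomology of `I` with respect to
`𝔪 = (x_1, …, x_n)`. -/
abbrev LocalCohomology (I : Ideal (MvPolynomial (Fin n) K)) (i j : ℤ) : Type _ :=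
  ↥(cechCocycles I i j) ⧸ (cechCoboundaries I i j).submoduleOf (cechCocycles I i j)

/-- `reg I = r`, where `reg I = max {i + j : H^i_𝔪(I)_j ≠ 0}`. -/
def HasRegularity (I : Ideal (MvPolynomial (Fin n) K)) (r : ℤ) : Prop :=
  IsGreatest {s : ℤ | ∃ i j : ℤ, Nontrivial (LocalCohomology I i j) ∧ s = i + j} r

end Regularity

end MonomialIdeals

end

/-!
The ideal is built from Sturmfels's ideal `J = (bcd, acd, abd, abc, cde, abe, adf, bcf)` in six
variables. Let `n = 6 + k + r` and `d = k + 3`: the generators of `J` are multiplied by `k` further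
variables, and the variable `a` is replaced by any one of `r + 1` variables. This keeps all the
properties involved (`expansion`, `exists_mem_linVars_expansion`, `monomialIdeal_expansion_sq`), so
that only the combinatorics of the eight generators of `J` and of the 36 generators of `J²` has to
be checked.

In a suitable lexicographic order the generators of `J` have linear quotients, and so have those of
`J²` with a single exception: `abcde²` and `abcdf²` both lie in `J²`, but no other generator divides
their least common multiple. The colon ideal of the later one, `abcdf²`, is therefore generated by
variables and the square `e²` (`linearQuotients_sixSqGens`).

*Upper bound for the regularity.* In multidegree `α` the Čech complex of a monomial ideal is the
complex of cochains on an upward closed family of sets of variables (`upset`). Adding the generators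
one at a time, each `x^u` contributes an interval of sets. An interval with more than one element is
a cone, hence acyclic, and the degree of the colon ideal bounds the total degree of a one-element
interval by `|u| + 1` (`acyclicAt_upset_insert_diff`, `acyclicAt_upset`). Hence `H^i(I²)_j = 0` for
`i + j > 2d + 1`.

*Lower bound.* In the squarefree multidegree of total degree `6 + k` supported on the six variables
and the common factors, the family consists of the proper supersets of the set of the `k` common
factors (`mem_upset_topDegree`), which has cohomology in cardinality `k + 1`; and
`(k + 1) + (6 + k) = 2d + 1`.

*No linear resolution.* The relation `e² · abcdf² = f² · abcde²` is not a combination of linear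
syzygies, since in any linear syzygy the coefficient of the generator extending `abcdf²` is free of
the variable `e` (`not_hasLinearResolution_monomialIdeal`).
-/

noncomputable section

namespace MonomialIdeals

/-! ### Cochains on families of subsets -/

section Cochains

variable {K : Type*} [Field K] {n : ℕ}

/-- The sign with which the facet `A \ {a}` enters the coboundary at `A`. -/
def facetSign (a : Fin n) (A : Finset (Fin n)) : ℤ :=
  (-1) ^ (A.filter (fun b => b < a)).card

theorem facetSign_mul_self (a : Fin n) (A : Finset (Fin n)) :
    facetSign a A * facetSign a A = 1 := by
  rw [facetSign, ← mul_pow]; simp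

theorem facetSign_erase {a : Fin n} {A : Finset (Fin n)} (ha : a ∈ A) (b : Fin n) :
    facetSign b A = (if a < b then -1 else 1) * facetSign b (A.erase a) := by
  unfold facetSign
  have he : (A.erase a).filter (fun c => c < b) = (A.filter (fun c => c < b)).erase a :=
    Finset.filter_erase _ _ _
  rw [he]
  split_ifs with h
  · have hm : a ∈ A.filter (fun c => c < b) := Finset.mem_filter.2 ⟨ha, h⟩
    rw [← Finset.card_erase_add_one hm, pow_succ]
    ring
  · have hm : a ∉ A.filter (fun c => c < b) := fun hc => h (Finset.mem_filter.1 hc).2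
    rw [Finset.erase_eq_of_notMem hm, one_mul]

theorem facetSign_mul_swap {a b : Fin n} {A : Finset (Fin n)} (ha : a ∈ A) (hb : b ∈ A)
    (hab : a ≠ b) :
    facetSign a A * facetSign b (A.erase a) = -(facetSign b A * facetSign a (A.erase b)) := by
  rw [facetSign_erase hb a, facetSign_erase ha b]
  rcases lt_or_gt_of_ne hab with h | h
  · rw [if_pos h, if_neg h.not_gt]; ring
  · rw [if_pos h, if_neg h.not_gt]; ring

/-- The coboundary of a cochain on the subsets of `Fin n`: the Čech differential in a single
multidegree. -/
def coboundary (K : Type*) [Field K] (n : ℕ) :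
    (Finset (Fin n) → K) →ₗ[K] (Finset (Fin n) → K) where
  toFun x A := ∑ a ∈ A, facetSign a A • x (A.erase a)
  map_add' x y := by
    funext A
    simp [smul_add, Finset.sum_add_distrib]
  map_smul' r x := by
    funext A
    simp only [Pi.smul_apply, RingHom.id_apply, Finset.smul_sum]
    exact Finset.sum_congr rfl fun a _ => smul_comm _ _ _

theorem coboundary_apply (x : Finset (Fin n) → K) (A : Finset (Fin n)) :
    coboundary K n x A = ∑ a ∈ A, facetSign a A • x (A.erase a) := rfl

theorem coboundary_coboundary (x : Finset (Fin n) → K) (A : Finset (Fin n)) :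
    coboundary K n (coboundary K n x) A = 0 := by
  simp only [coboundary_apply, Finset.smul_sum]
  rw [Finset.sum_sigma']
  refine Finset.sum_involution (fun p _ => ⟨p.2, p.1⟩) ?_ ?_ ?_ ?_
  · rintro ⟨a, b⟩ hp
    simp only [Finset.mem_sigma, Finset.mem_erase] at hp
    simp only [smul_smul]
    rw [facetSign_mul_swap hp.1 hp.2.2 (Ne.symm hp.2.1), Finset.erase_right_comm, neg_smul,
      neg_add_cancel]
  · rintro ⟨a, b⟩ hp _ h
    simp only [Finset.mem_sigma, Finset.mem_erase] at hp
    exact hp.2.1 (congrArg Sigma.fst h)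
  · rintro ⟨a, b⟩ hp
    simp only [Finset.mem_sigma, Finset.mem_erase] at hp ⊢
    exact ⟨hp.2.2, Ne.symm hp.2.1, hp.1⟩
  · rintro ⟨a, b⟩ _
    rfl

theorem exists_of_coboundary_ne_zero {x : Finset (Fin n) → K} {A : Finset (Fin n)}
    (h : coboundary K n x A ≠ 0) : ∃ a ∈ A, x (A.erase a) ≠ 0 := by
  obtain ⟨a, ha, h'⟩ := Finset.exists_ne_zero_of_sum_ne_zero h
  exact ⟨a, ha, fun h0 => h' (by rw [h0, smul_zero])⟩

/-- The complex of cochains on the family `D` of subsets is exact in cardinality `i`. The families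
that matter are differences of two upward closed families. -/
def AcyclicAt (K : Type*) [Field K] {n : ℕ} (D : Set (Finset (Fin n))) (i : ℤ) : Prop :=
  ∀ x : Finset (Fin n) → K, (∀ A, x A ≠ 0 → A ∈ D ∧ (A.card : ℤ) = i) →
    (∀ A ∈ D, coboundary K n x A = 0) →
    ∃ y : Finset (Fin n) → K, (∀ A, y A ≠ 0 → A ∈ D ∧ (A.card : ℤ) = i - 1) ∧
      ∀ A ∈ D, coboundary K n y A = x A

theorem acyclicAt_empty (i : ℤ) : AcyclicAt K (∅ : Set (Finset (Fin n))) i :=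
  fun _ _ _ => ⟨0, fun _ h => absurd rfl h, fun _ h => absurd h (Set.notMem_empty _)⟩

/-- A proper interval `[N, W]` is a cone over any vertex of `W \ N`, hence acyclic; the interval
`[N, N]` has cohomology only in cardinality `|N|`. -/
theorem acyclicAt_Icc (N W : Finset (Fin n)) (i : ℤ) (h : N = W → (N.card : ℤ) ≠ i) :
    AcyclicAt K (Set.Icc N W) i := by
  intro x hx hcyc
  by_cases hNW : N ⊆ W
  swap
  · exact ⟨0, fun _ h => absurd rfl h, fun A hA => absurd (hA.1.trans hA.2) hNW⟩
  by_cases heq : N = W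
  · subst heq
    have hx0 : x = 0 := by
      funext A
      by_contra hA
      obtain ⟨h1, h2⟩ := hx A hA
      have : A = N := le_antisymm h1.2 h1.1
      exact h rfl (this ▸ h2)
    exact ⟨0, fun _ h => absurd rfl h, fun A _ => by rw [hx0, map_zero]⟩
  obtain ⟨v, hvW, hvN⟩ := Finset.exists_of_ssubset (hNW.ssubset_of_ne heq)
  -- the contracting homotopy of the cone with apex `v`
  refine ⟨fun A => if v ∈ A then 0 else facetSign v (insert v A) • x (insert v A), ?_, ?_⟩
  · intro A hA
    by_cases hv : v ∈ A
    · simp [hv] at hA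
    · simp only [hv, if_false] at hA
      obtain ⟨h1, h2⟩ := hx (insert v A) (fun h0 => hA (by rw [h0, smul_zero]))
      rw [Finset.card_insert_of_notMem hv] at h2
      refine ⟨⟨?_, (Finset.subset_insert _ _).trans h1.2⟩, by push_cast at h2; omega⟩
      exact (Finset.subset_insert_iff_of_notMem hvN).1 h1.1
  · intro A hA
    rw [coboundary_apply]
    by_cases hv : v ∈ A
    · rw [Finset.sum_eq_single_of_mem v hv]
      · simp only [Finset.notMem_erase, if_false, Finset.insert_erase hv, smul_smul,
          facetSign_mul_self, one_smul]
      · intro a _ hav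
        simp [Finset.mem_erase, hv, Ne.symm hav]
    · have hins : insert v A ∈ Set.Icc N W :=
        ⟨hA.1.trans (Finset.subset_insert _ _), Finset.insert_subset hvW hA.2⟩
      have hc := hcyc _ hins
      rw [coboundary_apply, Finset.sum_insert hv, Finset.erase_insert hv] at hc
      have hc2 : x A = -∑ a ∈ A, (facetSign v (insert v A) * facetSign a (insert v A)) •
          x ((insert v A).erase a) := by
        have := congrArg (fun z => facetSign v (insert v A) • z) hc
        simp only [smul_add, smul_smul, facetSign_mul_self, one_smul, Finset.smul_sum,
          smul_zero] at this
        exact eq_neg_of_add_eq_zero_left this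
      rw [hc2, ← Finset.sum_neg_distrib]
      refine Finset.sum_congr rfl fun a ha => ?_
      have hav : a ≠ v := fun h => hv (h ▸ ha)
      have hva : v ∉ A.erase a := fun h => hv (Finset.mem_of_mem_erase h)
      have hset : insert v (A.erase a) = (insert v A).erase a :=
        (Finset.erase_insert_of_ne (Ne.symm hav)).symm
      have hsw := facetSign_mul_swap (Finset.mem_insert_self v A)
        (Finset.mem_insert_of_mem ha : a ∈ insert v A) (Ne.symm hav)
      rw [Finset.erase_insert hv] at hsw
      have h1 := facetSign_mul_self v (insert v A)
      have h2 := facetSign_mul_self v ((insert v A).erase a)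
      simp only [hva, if_false, hset, smul_smul, ← neg_smul]
      congr 1
      linear_combination (facetSign v (insert v A) * facetSign v ((insert v A).erase a)) * hsw -
        facetSign a A * facetSign v ((insert v A).erase a) * h1 -
        facetSign v (insert v A) * facetSign a (insert v A) * h2

/-- The long exact sequence of a pair `U ⊆ V` of upward closed families. -/
theorem AcyclicAt.of_diff {U V : Set (Finset (Fin n))} {i : ℤ} (hUV : U ⊆ V)
    (hU : IsUpperSet U) (hV : IsUpperSet V) (h1 : AcyclicAt K U i) (h2 : AcyclicAt K (V \ U) i) :
    AcyclicAt K V i := by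
  classical
  intro x hx hcyc
  obtain ⟨y, hy, hyx⟩ := h2 (fun A => if A ∈ U then 0 else x A)
    (fun A hA => by
      by_cases hAU : A ∈ U
      · simp [hAU] at hA
      · simp only [hAU, if_false] at hA
        exact ⟨⟨(hx A hA).1, hAU⟩, (hx A hA).2⟩)
    (fun A hA => by
      rw [← hcyc A hA.1, coboundary_apply, coboundary_apply]
      refine Finset.sum_congr rfl fun a _ => ?_
      rw [if_neg fun h => hA.2 (hU (Finset.erase_subset a A) h)])
  have hyU : ∀ A, coboundary K n y A ≠ 0 → A ∈ V ∧ (A.card : ℤ) = i := by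
    intro A hA
    obtain ⟨a, ha, hya⟩ := exists_of_coboundary_ne_zero hA
    refine ⟨hV (Finset.erase_subset a A) (hy _ hya).1.1, ?_⟩
    have h3 := (hy _ hya).2
    rw [← Finset.card_erase_add_one ha]
    push_cast
    omega
  obtain ⟨z, hz, hzx⟩ := h1 (x - coboundary K n y)
    (fun A hA => by
      have hAV : A ∈ V ∧ (A.card : ℤ) = i := by
        by_cases hxA : x A = 0
        · refine hyU A fun h0 => hA ?_
          rw [Pi.sub_apply, hxA, h0, sub_zero]
        · exact hx A hxA
      refine ⟨by_contra fun hAU => hA ?_, hAV.2⟩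
      rw [Pi.sub_apply, hyx A ⟨hAV.1, hAU⟩, if_neg hAU, sub_self])
    (fun A hA => by
      rw [map_sub, Pi.sub_apply, hcyc A (hUV hA), coboundary_coboundary, sub_zero])
  refine ⟨y + z, fun A hA => ?_, fun A hA => ?_⟩
  · by_cases hyA : y A = 0
    · have hzA : z A ≠ 0 := fun h0 => hA (by rw [Pi.add_apply, hyA, h0, add_zero])
      exact ⟨hUV (hz A hzA).1, (hz A hzA).2⟩
    · exact ⟨(hy A hyA).1.1, (hy A hyA).2⟩
  · rw [map_add, Pi.add_apply]
    by_cases hAU : A ∈ U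
    · rw [hzx A hAU, Pi.sub_apply]; ring
    · have hz0 : coboundary K n z A = 0 := by
        by_contra h0
        obtain ⟨a, _, hza⟩ := exists_of_coboundary_ne_zero h0
        exact hAU (hU (Finset.erase_subset a A) (hz _ hza).1)
      rw [hyx A ⟨hA, hAU⟩, if_neg hAU, hz0, add_zero]

end Cochains

/-! ### Colon ideals and the upward closed family of a multidegree -/

section Upset

variable {K : Type*} [Field K] {n : ℕ}

/-- The sets `A` such that `x^α` lies in the localization at `x_A` of the monomial ideal generated
by the monomials with exponents in `s`. -/
def upset (s : Set (Fin n →₀ ℕ)) (α : Fin n → ℤ) : Set (Finset (Fin n)) :=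
  {A | ∃ u ∈ s, ∀ i, i ∉ A → (u i : ℤ) ≤ α i}

theorem isUpperSet_upset (s : Set (Fin n →₀ ℕ)) (α : Fin n → ℤ) : IsUpperSet (upset s α) := by
  rintro A B hAB ⟨u, hu, h⟩
  exact ⟨u, hu, fun i hi => h i fun hA => hi (hAB hA)⟩

theorem upset_mono {s t : Set (Fin n →₀ ℕ)} (h : s ⊆ t) (α : Fin n → ℤ) :
    upset s α ⊆ upset t α := by
  rintro A ⟨u, hu, h'⟩
  exact ⟨u, h hu, h'⟩

/-- The variables (by index) in the colon ideal `(x^v : v ∈ s) : x^u`. -/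
def linVars (s : Set (Fin n →₀ ℕ)) (u : Fin n →₀ ℕ) : Set (Fin n) :=
  {t | ∃ v ∈ s, v ≤ u + Finsupp.single t 1}

/-- The indices of the variables whose square lies in the colon ideal `(x^v : v ∈ s) : x^u`. -/
def sqVars (s : Set (Fin n →₀ ℕ)) (u : Fin n →₀ ℕ) : Set (Fin n) :=
  {t | ∃ v ∈ s, v ≤ u + Finsupp.single t 2}

/-- The exponents `v ∈ s` that precede `u` when `s` is ordered by the key `f`. -/
def earlier {κ : Type*} [LT κ] (f : (Fin n →₀ ℕ) → κ) (s : Set (Fin n →₀ ℕ)) (u : Fin n →₀ ℕ) :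
    Set (Fin n →₀ ℕ) :=
  {v ∈ s | f v < f u}

/-- If the colon ideal of `x^u` by the previous generators is generated by variables and possibly
the square of one variable `x_q`, then in each multidegree the sets added by `u` form an interval,
and this interval is a point only in total degree at most `|u| + 1`. -/
theorem acyclicAt_upset_insert_diff (s : Set (Fin n →₀ ℕ)) (u : Fin n →₀ ℕ) (q : Fin n)
    (h : ∀ v ∈ s, (∃ t ∈ linVars s u, u t < v t) ∨ (q ∈ sqVars s u ∧ u q + 2 ≤ v q))
    (α : Fin n → ℤ) (i : ℤ) (hi : (u.degree : ℤ) + 1 < i + ∑ a, α a) :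
    AcyclicAt K (upset (insert u s) α \ upset s α) i := by
  classical
  rcases (upset (insert u s) α \ upset s α).eq_empty_or_nonempty with hD | ⟨A₀, hA₀⟩
  · rw [hD]; exact acyclicAt_empty i
  set N : Finset (Fin n) := Finset.univ.filter fun a => α a < u a with hN
  have hmemN : ∀ a, a ∈ N ↔ α a < u a := fun a => by simp [hN]
  have hsub : ∀ A ∈ upset (insert u s) α \ upset s α, N ⊆ A := by
    rintro A ⟨⟨v, hv, hvA⟩, hA⟩ a ha
    rcases hv with rfl | hv
    · by_contra h'
      exact absurd (hvA a h') (not_le.2 ((hmemN a).1 ha))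
    · exact absurd ⟨v, hv, hvA⟩ hA
  have hlin : ∀ t ∈ linVars s u, α t = u t ∧
      ∀ A ∈ upset (insert u s) α \ upset s α, t ∉ A := by
    rintro t ⟨v, hv, hvu⟩
    have hout : ∀ A ∈ upset (insert u s) α \ upset s α, t ∉ A := by
      intro A hA ht
      refine hA.2 ⟨v, hv, fun a ha => ?_⟩
      have hat : t ≠ a := fun h => ha (h ▸ ht)
      have h1 : v a ≤ u a := by
        have := hvu a
        simpa [Finsupp.single_apply, hat] using this
      have h2 : ¬ α a < u a := fun h' => ha (hsub A hA ((hmemN a).2 h'))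
      omega
    refine ⟨?_, hout⟩
    have h1 : ¬ α t < u t := fun h' => hout A₀ hA₀ (hsub A₀ hA₀ ((hmemN t).2 h'))
    by_contra h2
    refine hA₀.2 ⟨v, hv, fun a ha => ?_⟩
    have h3 : v a ≤ u a + if t = a then 1 else 0 := by
      have := hvu a
      simpa [Finsupp.single_apply] using this
    have h4 : ¬ α a < u a := fun h' => ha (hsub A₀ hA₀ ((hmemN a).2 h'))
    split_ifs at h3 with hta
    · subst hta; omega
    · omega
  have hsq : q ∈ sqVars s u → α q ≤ u q + 1 ∧
      ∀ A ∈ upset (insert u s) α \ upset s α, q ∉ A := by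
    rintro ⟨v, hv, hvu⟩
    constructor
    · by_contra h2
      refine hA₀.2 ⟨v, hv, fun a ha => ?_⟩
      have h3 : v a ≤ u a + if q = a then 2 else 0 := by
        have := hvu a
        simpa [Finsupp.single_apply] using this
      have h4 : ¬ α a < u a := fun h' => ha (hsub A₀ hA₀ ((hmemN a).2 h'))
      split_ifs at h3 with hta
      · subst hta; omega
      · omega
    · intro A hA ht
      refine hA.2 ⟨v, hv, fun a ha => ?_⟩
      have hat : q ≠ a := fun h => ha (h ▸ ht)
      have h1 : v a ≤ u a := by
        have := hvu a
        simpa [Finsupp.single_apply, hat] using this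
      have h2 : ¬ α a < u a := fun h' => ha (hsub A hA ((hmemN a).2 h'))
      omega
  set W : Finset (Fin n) :=
    Finset.univ.filter fun a => a ∉ linVars s u ∧ ¬ (a = q ∧ q ∈ sqVars s u) with hW
  have hmemW : ∀ a, a ∈ W ↔ a ∉ linVars s u ∧ ¬ (a = q ∧ q ∈ sqVars s u) := fun a => by simp [hW]
  have hIcc : upset (insert u s) α \ upset s α = Set.Icc N W := by
    ext A
    refine ⟨fun hA => ⟨hsub A hA, fun a ha => (hmemW a).2 ⟨fun hl => (hlin a hl).2 A hA ha, ?_⟩⟩,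
      fun hA => ⟨⟨u, Set.mem_insert _ _, fun a ha => ?_⟩, ?_⟩⟩
    · rintro ⟨rfl, hq⟩
      exact (hsq hq).2 A hA ha
    · exact not_lt.1 fun h' => ha (hA.1 ((hmemN a).2 h'))
    · rintro ⟨v, hv, hvA⟩
      rcases h v hv with ⟨t, ht, huv⟩ | ⟨hq, huv⟩
      · have h1 := hvA t fun htA => ((hmemW t).1 (hA.2 htA)).1 ht
        have h2 := (hlin t ht).1
        omega
      · have h1 := hvA q fun htA => ((hmemW q).1 (hA.2 htA)).2 ⟨rfl, hq⟩
        have h2 := (hsq hq).1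
        omega
  rw [hIcc]
  refine acyclicAt_Icc N W i fun hNW hcard => ?_
  have hbound : ∀ a, α a + (if a ∈ N then 1 else 0) ≤ u a + if a = q then 1 else 0 := by
    intro a
    by_cases haN : a ∈ N
    · have := (hmemN a).1 haN
      rw [if_pos haN]
      split_ifs <;> omega
    · rw [if_neg haN]
      by_cases hal : a ∈ linVars s u
      · have := (hlin a hal).1
        split_ifs <;> omega
      · have : a = q ∧ q ∈ sqVars s u := by
          by_contra h'
          exact haN (hNW ▸ (hmemW a).2 ⟨hal, h'⟩)
        have h3 := (hsq this.2).1
        rw [if_pos this.1, this.1]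
        omega
  have hsum := Finset.sum_le_sum fun a (_ : a ∈ Finset.univ) => hbound a
  rw [Finset.sum_add_distrib, Finset.sum_add_distrib] at hsum
  have hdeg : (u.degree : ℤ) = ∑ a, (u a : ℤ) := by
    rw [Finsupp.degree_eq_sum]; push_cast; rfl
  simp only [Finset.sum_ite_mem, Finset.univ_inter, Finset.sum_const, Finset.sum_ite_eq',
    Finset.mem_univ, if_true, nsmul_eq_mul, mul_one] at hsum
  omega

/-- Vanishing above the line `i + |α| = D + 1`, by adding the generators one at a time. -/
theorem acyclicAt_upset {κ : Type*} [LinearOrder κ] (f : (Fin n →₀ ℕ) → κ)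
    (hf : Function.Injective f) (q : Fin n) (D : ℕ) (G : Finset (Fin n →₀ ℕ))
    (hdeg : ∀ u ∈ G, u.degree = D)
    (h : ∀ u ∈ G, ∀ v ∈ earlier f G u, (∃ t ∈ linVars (earlier f G u) u, u t < v t) ∨
      (q ∈ sqVars (earlier f G u) u ∧ u q + 2 ≤ v q))
    (α : Fin n → ℤ) (i : ℤ) (hi : (D : ℤ) + 1 < i + ∑ a, α a) :
    AcyclicAt K (upset (G : Set (Fin n →₀ ℕ)) α) i := by
  classical
  induction G using Finset.induction_on_max_value f with
  | empty =>
    have : upset ((∅ : Finset (Fin n →₀ ℕ)) : Set (Fin n →₀ ℕ)) α = ∅ := by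
      ext A; simp [upset]
    rw [this]
    exact acyclicAt_empty i
  | insert a s ha hmax ih =>
    have hs : earlier f (insert a s : Finset (Fin n →₀ ℕ)) a = s := by
      ext v
      simp only [earlier, Finset.coe_insert, Set.mem_insert_iff, Finset.mem_coe, Set.mem_ofPred_eq]
      refine ⟨fun ⟨h1, h2⟩ => h1.resolve_left fun h3 => absurd h2 (h3 ▸ lt_irrefl _),
        fun hv => ⟨Or.inr hv, lt_of_le_of_ne (hmax v hv) fun h3 => ha (hf h3 ▸ hv)⟩⟩
    have hs' : ∀ u ∈ s, earlier f (insert a s : Finset (Fin n →₀ ℕ)) u = earlier f s u := by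
      intro u hu
      ext v
      simp only [earlier, Finset.coe_insert, Set.mem_insert_iff, Finset.mem_coe, Set.mem_ofPred_eq]
      refine ⟨fun ⟨h1, h2⟩ => ⟨h1.resolve_left fun h3 => ?_, h2⟩, fun hv => ⟨Or.inr hv.1, hv.2⟩⟩
      exact absurd h2 (h3 ▸ (hmax u hu).not_gt)
    have hstep := h a (Finset.mem_insert_self a s)
    rw [hs] at hstep
    rw [Finset.coe_insert]
    refine AcyclicAt.of_diff (upset_mono (Set.subset_insert _ _) α) (isUpperSet_upset _ _)
      (isUpperSet_upset _ _) (ih (fun u hu => hdeg u (Finset.mem_insert_of_mem hu)) ?_)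
      (acyclicAt_upset_insert_diff _ _ q hstep α i ?_)
    · intro u hu
      have := h u (Finset.mem_insert_of_mem hu)
      rwa [hs' u hu] at this
    · rwa [hdeg a (Finset.mem_insert_self a s)]

end Upset

/-! ### Multigraded pieces of the Čech complex -/

section Cech

variable {K : Type*} [Field K] {n : ℕ}

theorem toLaurent_monomial (u : Fin n →₀ ℕ) (r : K) :
    toLaurent K n (MvPolynomial.monomial u r) =
      AddMonoidAlgebra.single (fun i => (u i : ℤ)) r := by
  have hu : (fun i => (u i : ℤ)) = ∑ i, u i • (Pi.single i 1 : Fin n → ℤ) := by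
    funext j
    simp [Finset.sum_apply, Pi.single_apply]
  have hp : ∏ i, (AddMonoidAlgebra.single (Pi.single i 1 : Fin n → ℤ) (1 : K)) ^ u i =
      AddMonoidAlgebra.single (∑ i, u i • (Pi.single i 1 : Fin n → ℤ)) 1 := by
    induction (Finset.univ : Finset (Fin n)) using Finset.induction_on with
    | empty => rfl
    | insert a s ha ih =>
      rw [Finset.prod_insert ha, Finset.sum_insert ha, ih, AddMonoidAlgebra.single_pow,
        AddMonoidAlgebra.single_mul_single, one_pow, one_mul]
  rw [toLaurent, MvPolynomial.aeval_monomial, Finsupp.prod_fintype _ _ (fun i => pow_zero _), hp,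
    hu, ← Algebra.smul_def, AddMonoidAlgebra.smul_single]
  simp

theorem toLaurent_prod_X_pow (A : Finset (Fin n)) (k : ℕ) :
    toLaurent K n (∏ a ∈ A, MvPolynomial.X a) ^ k =
      AddMonoidAlgebra.single (fun i => if i ∈ A then (k : ℤ) else 0) 1 := by
  have h : ((∏ a ∈ A, MvPolynomial.X a : MvPolynomial (Fin n) K)) ^ k =
      MvPolynomial.monomial (∑ a ∈ A, Finsupp.single a k) 1 := by
    rw [MvPolynomial.monomial_sum_one, ← Finset.prod_pow]
    exact Finset.prod_congr rfl fun a _ => (MvPolynomial.X_pow_eq_monomial)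
  rw [← map_pow, h, toLaurent_monomial]
  congr 1
  funext i
  simp [Finsupp.single_apply]

theorem exists_mem_support_of_coeff_toLaurent_ne_zero {p : MvPolynomial (Fin n) K}
    {β : Fin n → ℤ} (h : (toLaurent K n p).coeff β ≠ 0) :
    ∃ u ∈ p.support, β = fun i => (u i : ℤ) := by
  rw [p.as_sum, map_sum, AddMonoidAlgebra.coeff_sum, Finsupp.finsetSum_apply] at h
  obtain ⟨u, hu, h'⟩ := Finset.exists_ne_zero_of_sum_ne_zero h
  rw [toLaurent_monomial, AddMonoidAlgebra.coeff_single, Finsupp.single_apply] at h'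
  exact ⟨u, hu, by by_contra hne; exact h' (if_neg (Ne.symm hne))⟩

theorem sum_single_coeff (f : Laurent K n) {S : Finset (Fin n → ℤ)} (hS : f.coeff.support ⊆ S) :
    ∑ α ∈ S, AddMonoidAlgebra.single α (f.coeff α) = f := by
  ext β
  rw [AddMonoidAlgebra.coeff_sum, Finsupp.finsetSum_apply]
  simp only [AddMonoidAlgebra.coeff_single, Finsupp.single_apply]
  rw [Finset.sum_ite_eq' S β]
  split_ifs with h
  · rfl
  · by_contra hne
    exact h (hS (Finsupp.mem_support_iff.2 (Ne.symm hne)))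

theorem mem_localizedIdeal_span_iff (s : Set (Fin n →₀ ℕ)) (A : Finset (Fin n))
    (f : Laurent K n) :
    f ∈ localizedIdeal (Ideal.span ((fun u => MvPolynomial.monomial u (1 : K)) '' s)) A ↔
      ∀ α, f.coeff α ≠ 0 → A ∈ upset s α := by
  constructor
  · rintro ⟨k, p, hp, hf⟩ α hα
    rw [toLaurent_prod_X_pow] at hf
    have hc : (toLaurent K n p).coeff ((fun i => if i ∈ A then (k : ℤ) else 0) + α) ≠ 0 := by
      rw [← hf, AddMonoidAlgebra.coeff_single_mul_eq_mul_coeff α (by simp), one_mul]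
      exact hα
    obtain ⟨u, hu, hαu⟩ := exists_mem_support_of_coeff_toLaurent_ne_zero hc
    obtain ⟨v, hv, hvu⟩ := MvPolynomial.mem_ideal_span_monomial_image.1 hp u hu
    refine ⟨v, hv, fun i hi => ?_⟩
    have := congrFun hαu i
    simp only [Pi.add_apply, if_neg hi, zero_add] at this
    rw [this]
    exact_mod_cast hvu i
  · intro h
    rw [← sum_single_coeff f subset_rfl]
    refine Submodule.sum_mem _ fun α hα => ?_
    obtain ⟨u, hu, huα⟩ := h α (Finsupp.mem_support_iff.1 hα)
    -- a power of `x_A` large enough to clear all denominators and to reach the exponent `u` on `A`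
    set k : ℕ := ∑ i, ((α i).natAbs + u i) with hk
    have hle : ∀ i, (α i).natAbs + u i ≤ k := fun i =>
      Finset.single_le_sum (f := fun i => (α i).natAbs + u i) (fun _ _ => Nat.zero_le _)
        (Finset.mem_univ i)
    set β : Fin n →₀ ℕ := Finsupp.equivFunOnFinite.symm
      fun i => ((if i ∈ A then (k : ℤ) else 0) + α i).toNat with hβ
    have hβi : ∀ i, (u i : ℤ) ≤ (if i ∈ A then (k : ℤ) else 0) + α i := by
      intro i
      split_ifs with hi
      · have := hle i
        omega
      · rw [zero_add]; exact huα i hi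
    have hβ' : ∀ i, (β i : ℤ) = (if i ∈ A then (k : ℤ) else 0) + α i := by
      intro i
      have h1 := hβi i
      simp only [hβ, Finsupp.equivFunOnFinite_symm_apply_apply]
      exact Int.toNat_of_nonneg (le_trans (Int.natCast_nonneg _) h1)
    refine ⟨k, MvPolynomial.monomial β (f.coeff α), ?_, ?_⟩
    · refine MvPolynomial.mem_ideal_span_monomial_image.2 fun v hv => ⟨u, hu, ?_⟩
      rw [Finset.mem_singleton.1 (MvPolynomial.support_monomial_subset hv)]
      intro i
      have h1 := hβi i
      rw [← hβ' i] at h1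
      exact_mod_cast h1
    · rw [toLaurent_prod_X_pow, toLaurent_monomial, AddMonoidAlgebra.single_mul_single, one_mul]
      congr 1
      funext i
      exact (hβ' i).symm

theorem mem_homogeneousLaurent_iff (j : ℤ) (f : Laurent K n) :
    f ∈ homogeneousLaurent K n j ↔ ∀ α, f.coeff α ≠ 0 → ∑ a, α a = j := by
  refine (AddMonoidAlgebra.mem_gradeBy_iff _ _ _ _).trans ?_
  simp [Set.subset_def]

theorem mem_cechCochains_iff (s : Set (Fin n →₀ ℕ)) (i j : ℤ)
    (c : Finset (Fin n) → Laurent K n) :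
    c ∈ cechCochains (Ideal.span ((fun u => MvPolynomial.monomial u (1 : K)) '' s)) i j ↔
      ∀ A α, (c A).coeff α ≠ 0 → A ∈ upset s α ∧ (A.card : ℤ) = i ∧ ∑ a, α a = j := by
  rw [cechCochains, Submodule.mem_pi]
  simp only [Set.mem_univ, true_imp_iff]
  refine forall_congr' fun A => ?_
  split_ifs with h
  · rw [Submodule.mem_inf, mem_localizedIdeal_span_iff, mem_homogeneousLaurent_iff]
    exact ⟨fun h' α hα => ⟨h'.1 α hα, h, h'.2 α hα⟩,
      fun h' => ⟨fun α hα => (h' α hα).1, fun α hα => (h' α hα).2.2⟩⟩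
  · rw [Submodule.mem_bot]
    refine ⟨fun h' α hα => absurd (by rw [h']; rfl) hα, fun h' => ?_⟩
    ext α
    by_contra hα
    exact h (h' α hα).2.1

theorem coeff_cechDiff (c : Finset (Fin n) → Laurent K n) (A : Finset (Fin n))
    (α : Fin n → ℤ) :
    (cechDiff K n c A).coeff α = coboundary K n (fun B => (c B).coeff α) A := by
  change (∑ a ∈ A, (-1 : ℤ) ^ (A.filter (fun b => b < a)).card • c (A.erase a)).coeff α = _
  rw [AddMonoidAlgebra.coeff_sum, Finsupp.finsetSum_apply, coboundary_apply]
  rfl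

/-- If the complexes of the upward closed families of all multidegrees of total degree `j` are
exact in cardinality `i`, then `H^i_𝔪(I)_j = 0`. -/
theorem not_nontrivial_localCohomology (s : Set (Fin n →₀ ℕ)) (i j : ℤ)
    (h : ∀ α : Fin n → ℤ, ∑ a, α a = j → AcyclicAt K (upset s α) i) :
    ¬ Nontrivial (LocalCohomology
      (Ideal.span ((fun u => MvPolynomial.monomial u (1 : K)) '' s)) i j) := by
  classical
  rw [not_nontrivial_iff_subsingleton, Submodule.Quotient.subsingleton_iff,
    Submodule.submoduleOf_eq_top]
  rintro c ⟨hc, hker⟩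
  have hc' := (mem_cechCochains_iff s i j c).1 hc
  have hker' : cechDiff K n c = 0 := hker
  have hex : ∀ α : Fin n → ℤ, ∃ y : Finset (Fin n) → K,
      (∀ A, y A ≠ 0 → A ∈ upset s α ∧ (A.card : ℤ) = i - 1 ∧ ∑ a, α a = j) ∧
      ∀ A, coboundary K n y A = (c A).coeff α := by
    intro α
    by_cases hα : ∑ a, α a = j
    · obtain ⟨y, hy, hyc⟩ := h α hα (fun A => (c A).coeff α)
        (fun A hA => ⟨(hc' A α hA).1, (hc' A α hA).2.1⟩)
        (fun A _ => by rw [← coeff_cechDiff, hker']; rfl)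
      refine ⟨y, fun A hA => ⟨(hy A hA).1, (hy A hA).2, hα⟩, fun A => ?_⟩
      by_cases hA : A ∈ upset s α
      · exact hyc A hA
      · have h1 : (c A).coeff α = 0 := by
          by_contra h0; exact hA (hc' A α h0).1
        rw [h1]
        by_contra h0
        obtain ⟨a, _, ha⟩ := exists_of_coboundary_ne_zero h0
        exact hA (isUpperSet_upset s α (Finset.erase_subset a A) (hy _ ha).1)
    · refine ⟨0, fun A hA => absurd rfl hA, fun A => ?_⟩
      rw [map_zero, Pi.zero_apply]
      by_contra h0
      exact hα (hc' A α (Ne.symm h0)).2.2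
  choose y hy hyc using hex
  set S : Finset (Fin n → ℤ) := Finset.univ.biUnion fun A => (c A).coeff.support with hS
  have hcoeff : ∀ A α, (∑ β ∈ S, AddMonoidAlgebra.single β (y β A) : Laurent K n).coeff α =
      if α ∈ S then y α A else 0 := by
    intro A α
    rw [AddMonoidAlgebra.coeff_sum, Finsupp.finsetSum_apply]
    simp only [AddMonoidAlgebra.coeff_single, Finsupp.single_apply]
    rw [Finset.sum_ite_eq' S α]
  refine ⟨fun A => ∑ β ∈ S, AddMonoidAlgebra.single β (y β A), ?_, ?_⟩
  · refine (mem_cechCochains_iff s (i - 1) j _).2 fun A α hA => ?_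
    rw [hcoeff] at hA
    exact hy α A fun h0 => hA (by rw [h0, ite_self])
  · funext A
    ext α
    rw [coeff_cechDiff]
    simp only [hcoeff]
    by_cases hα : α ∈ S
    · simp only [hα, if_true]
      exact hyc α A
    · simp only [hα, if_false]
      have h1 : (c A).coeff α = 0 := by
        by_contra h0
        exact hα (Finset.mem_biUnion.2 ⟨A, Finset.mem_univ _, Finsupp.mem_support_iff.2 h0⟩)
      rw [h1]
      exact congrFun (map_zero (coboundary K n)) A

/-- If in multidegree `α` the family consists of the proper supersets of a set `Z ≠ univ`, then the
coboundary of the indicator of `Z` is a nonzero class: the indicator itself is not a cochain. -/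
theorem nontrivial_localCohomology (s : Set (Fin n →₀ ℕ)) (α : Fin n → ℤ) (Z : Finset (Fin n))
    (hZ : ∀ A, A ∈ upset s α ↔ Z ⊂ A) (x₀ : Fin n) (hx₀ : x₀ ∉ Z) :
    Nontrivial (LocalCohomology
      (Ideal.span ((fun u => MvPolynomial.monomial u (1 : K)) '' s)) (Z.card + 1) (∑ a, α a)) := by
  classical
  set x : Finset (Fin n) → K := coboundary K n (Pi.single Z 1) with hx
  have hxne : ∀ A, x A ≠ 0 → Z ⊂ A ∧ A.card = Z.card + 1 := by
    intro A hA
    obtain ⟨a, ha, h⟩ := exists_of_coboundary_ne_zero hA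
    have : A.erase a = Z := by
      by_contra hne
      exact h (Pi.single_eq_of_ne hne _)
    rw [← this]
    exact ⟨Finset.erase_ssubset ha, (Finset.card_erase_add_one ha).symm⟩
  have hx1 : x (insert x₀ Z) ≠ 0 := by
    have h1 : x (insert x₀ Z) = facetSign x₀ (insert x₀ Z) • (1 : K) := by
      rw [hx, coboundary_apply, Finset.sum_eq_single_of_mem x₀ (Finset.mem_insert_self _ _)]
      · rw [Finset.erase_insert hx₀, Pi.single_eq_same]
      · intro a ha hne
        rw [Pi.single_eq_of_ne, smul_zero]
        intro h
        exact hx₀ (h ▸ Finset.mem_erase.2 ⟨hne.symm, Finset.mem_insert_self _ _⟩)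
    intro h0
    have := congrArg (fun z => facetSign x₀ (insert x₀ Z) • z) (h1.symm.trans h0)
    simp only [smul_smul, facetSign_mul_self, one_smul, smul_zero] at this
    exact one_ne_zero this
  rw [← not_subsingleton_iff_nontrivial, Submodule.Quotient.subsingleton_iff,
    Submodule.submoduleOf_eq_top]
  intro hle
  have hcoeff : ∀ A β, (AddMonoidAlgebra.single α (x A) : Laurent K n).coeff β =
      if α = β then x A else 0 := fun A β => by
    rw [AddMonoidAlgebra.coeff_single, Finsupp.single_apply]
  obtain ⟨c, hc, hcx⟩ := hle (x := fun A => AddMonoidAlgebra.single α (x A)) ⟨by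
      refine (mem_cechCochains_iff s _ _ _).2 fun A β hA => ?_
      rw [hcoeff] at hA
      split_ifs at hA with hαβ
      · subst hαβ
        exact ⟨(hZ A).2 (hxne A hA).1, by exact_mod_cast (hxne A hA).2, rfl⟩
      · exact absurd rfl hA, by
      refine LinearMap.mem_ker.2 ?_
      funext A
      ext β
      rw [coeff_cechDiff]
      simp only [hcoeff]
      split_ifs
      · exact coboundary_coboundary _ A
      · exact congrFun (map_zero (coboundary K n)) A⟩
  have hc' := (mem_cechCochains_iff s _ _ c).1 hc
  have h2 := congrArg (fun f => (f (insert x₀ Z)).coeff α) hcx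
  simp only [coeff_cechDiff, hcoeff, if_true] at h2
  rw [← h2] at hx1
  obtain ⟨a, _, h3⟩ := exists_of_coboundary_ne_zero hx1
  obtain ⟨h4, h5, _⟩ := hc' _ _ h3
  have := Finset.card_lt_card ((hZ _).1 h4)
  omega

end Cech

/-! ### Monomial ideals generated in one degree -/

section Ideals

variable {K : Type*} [Field K] {n : ℕ}

/-- The ideal generated by the monomials with exponents in `s`. -/
def monomialIdeal (K : Type*) [Field K] {n : ℕ} (s : Set (Fin n →₀ ℕ)) :
    Ideal (MvPolynomial (Fin n) K) :=
  Ideal.span ((fun u => MvPolynomial.monomial u (1 : K)) '' s)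

theorem mem_monomialIdeal {s : Set (Fin n →₀ ℕ)} {p : MvPolynomial (Fin n) K} :
    p ∈ monomialIdeal K s ↔ ∀ e ∈ p.support, ∃ u ∈ s, u ≤ e :=
  MvPolynomial.mem_ideal_span_monomial_image

theorem monomial_mem_monomialIdeal {s : Set (Fin n →₀ ℕ)} {v : Fin n →₀ ℕ} :
    MvPolynomial.monomial v (1 : K) ∈ monomialIdeal K s ↔ ∃ u ∈ s, u ≤ v := by
  classical
  rw [mem_monomialIdeal, MvPolynomial.support_monomial, if_neg one_ne_zero]
  simp

theorem eq_of_le_of_degree_eq {u v : Fin n →₀ ℕ} (h : u ≤ v) (hd : u.degree = v.degree) :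
    u = v := by
  obtain ⟨w, rfl⟩ := exists_add_of_le h
  rw [map_add] at hd
  have : w = 0 := (Finsupp.degree_eq_zero_iff w).1 (by omega)
  rw [this, add_zero]

theorem minGens_monomialIdeal {s : Set (Fin n →₀ ℕ)} {D : ℕ} (hs : ∀ u ∈ s, u.degree = D) :
    minGens (monomialIdeal K s) = s := by
  ext u
  simp only [minGens, monomial_mem_monomialIdeal, Set.mem_ofPred_eq]
  constructor
  · rintro ⟨⟨v, hv, hvu⟩, hmin⟩
    rwa [le_antisymm (hmin ⟨v, hv, le_rfl⟩ hvu) hvu]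
  · refine fun hu => ⟨⟨u, hu, le_rfl⟩, ?_⟩
    rintro v ⟨w, hw, hwv⟩ hvu
    rwa [← eq_of_le_of_degree_eq (hwv.trans hvu) ((hs w hw).trans (hs u hu).symm)]

theorem colon_monomialIdeal (s : Set (Fin n →₀ ℕ)) (u : Fin n →₀ ℕ)
    (h : ∀ v ∈ s, ∃ t ∈ linVars s u, u t < v t) :
    (monomialIdeal K s).colon {MvPolynomial.monomial u (1 : K)} =
      Ideal.span ((fun i => (MvPolynomial.X i : MvPolynomial (Fin n) K)) '' linVars s u) := by
  apply le_antisymm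
  · intro p hp
    rw [Submodule.mem_colon_singleton, smul_eq_mul, mem_monomialIdeal] at hp
    refine MvPolynomial.mem_ideal_span_X_image.2 fun e he => ?_
    obtain ⟨v, hv, hve⟩ := hp (e + u) (by
      rw [MvPolynomial.mem_support_iff, MvPolynomial.coeff_mul_monomial, mul_one]
      exact MvPolynomial.mem_support_iff.1 he)
    obtain ⟨t, ht, hut⟩ := h v hv
    refine ⟨t, ht, fun h0 => ?_⟩
    have := hve t
    rw [Finsupp.add_apply, h0, zero_add] at this
    omega
  · rw [Ideal.span_le]
    rintro _ ⟨t, ⟨v, hv, hvu⟩, rfl⟩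
    refine Submodule.mem_colon_singleton.2 ?_
    change MvPolynomial.monomial (Finsupp.single t 1) (1 : K) * MvPolynomial.monomial u 1 ∈ _
    rw [MvPolynomial.monomial_mul, one_mul]
    exact monomial_mem_monomialIdeal.2 ⟨v, hv, by rwa [add_comm]⟩

theorem hasLinearQuotients_monomialIdeal {κ : Type*} [LinearOrder κ] (f : (Fin n →₀ ℕ) → κ)
    (hf : Function.Injective f) (D : ℕ) (G : Finset (Fin n →₀ ℕ)) (hdeg : ∀ u ∈ G, u.degree = D)
    (h : ∀ u ∈ G, ∀ v ∈ earlier f G u, ∃ t ∈ linVars (earlier f G u) u, u t < v t) :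
    HasLinearQuotients (monomialIdeal K (G : Set (Fin n →₀ ℕ))) := by
  classical
  have hcard : (G.image f).card = G.card := Finset.card_image_of_injective _ hf
  set e := (G.image f).orderEmbOfFin hcard with he
  have hex : ∀ j, ∃ u ∈ G, f u = e j := fun j =>
    Finset.mem_image.1 (Finset.orderEmbOfFin_mem _ hcard j)
  choose u hu hue using hex
  have hsurj : ∀ v ∈ G, ∃ j, u j = v := by
    intro v hv
    have : f v ∈ Set.range e := by
      rw [he, Finset.range_orderEmbOfFin]
      exact Finset.mem_coe.2 (Finset.mem_image_of_mem f hv)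
    obtain ⟨j, hj⟩ := this
    exact ⟨j, hf ((hue j).trans hj)⟩
  refine ⟨G.card, u, fun i j hij => e.injective ?_, ?_, fun j => ?_⟩
  · rw [← hue i, ← hue j, hij]
  · rw [minGens_monomialIdeal hdeg]
    ext v
    exact ⟨fun ⟨j, hj⟩ => hj ▸ hu j, fun hv => hsurj v hv⟩
  · have himg : u '' {k | k < j} = earlier f G (u j) := by
      ext v
      constructor
      · rintro ⟨k, hk, rfl⟩
        refine ⟨hu k, ?_⟩
        rw [hue k, hue j]
        exact e.strictMono hk
      · rintro ⟨hv, hlt⟩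
        obtain ⟨k, rfl⟩ := hsurj v hv
        rw [hue k, hue j] at hlt
        exact ⟨k, e.lt_iff_lt.1 hlt, rfl⟩
    refine ⟨linVars (earlier f G (u j)) (u j), ?_⟩
    rw [← colon_monomialIdeal _ _ (h (u j) (hu j)), monomialIdeal, ← himg, Set.image_image]

/-- A product in which only one pair of exponents contributes to a given coefficient. -/
theorem coeff_add_mul_of_forall {p r : MvPolynomial (Fin n) K} {e u : Fin n →₀ ℕ}
    (h : ∀ e' w, e' + w = e + u → p.coeff e' ≠ 0 → r.coeff w ≠ 0 → w = u) :
    (p * r).coeff (e + u) = p.coeff e * r.coeff u := by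
  classical
  rw [MvPolynomial.coeff_mul, Finset.sum_eq_single_of_mem (e, u)]
  · exact Finset.HasAntidiagonal.mem_antidiagonal.2 rfl
  · rintro ⟨e', w⟩ hm hne
    rw [Finset.HasAntidiagonal.mem_antidiagonal] at hm
    by_contra h0
    have hw := h e' w hm (left_ne_zero_of_mul h0) (right_ne_zero_of_mul h0)
    simp only at hm
    rw [hw] at hm
    exact hne (Prod.ext (add_right_cancel hm) hw)

theorem eq_single_of_add_eq {e w : Fin n →₀ ℕ} {q : Fin n} (he : e.degree = 1)
    (h : w + e = Finsupp.single q 1 + Finsupp.single q 1) : e = Finsupp.single q 1 := by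
  have hle : e ≤ Finsupp.single q 2 := by
    rw [show Finsupp.single q 2 = w + e by rw [h, ← Finsupp.single_add]]
    exact le_add_self
  have hz : ∀ a, a ≠ q → e a = 0 := fun a ha => by
    have := hle a
    rw [Finsupp.single_eq_of_ne ha] at this
    omega
  rw [Finsupp.degree_eq_sum, Finset.sum_eq_single_of_mem q (Finset.mem_univ q)
    (fun a _ ha => hz a ha)] at he
  ext a
  by_cases ha : a = q
  · rw [ha, he, Finsupp.single_eq_same]
  · rw [hz a ha, Finsupp.single_eq_of_ne ha]

theorem apply_eq_sum_single {R M : Type*} [CommSemiring R] [AddCommMonoid M] [Module R M] {m : ℕ}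
    (L : (Fin m → R) →ₗ[R] M) (y : Fin m → R) : L y = ∑ k, y k • L (Pi.single k 1) := by
  rw [LinearMap.pi_apply_eq_sum_univ L y]
  refine Finset.sum_congr rfl fun k _ => ?_
  congr 2
  funext j
  simp [Pi.single_apply, eq_comm]

/-- If `x_q² x^u = x_p² x^v` is a relation between two generators and no generator other than
`x^u` divides `x_q x^u`, then this relation is not a combination of linear syzygies: in every
linear syzygy the coefficient of `x^u` does not involve `x_q`. -/
theorem not_hasLinearResolution_monomialIdeal (s : Set (Fin n →₀ ℕ)) (D : ℕ)
    (hs : ∀ u ∈ s, u.degree = D) {u v : Fin n →₀ ℕ} (hu : u ∈ s) (hv : v ∈ s) {p q : Fin n}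
    (hpq : p ≠ q) (huv : u + Finsupp.single q 2 = v + Finsupp.single p 2)
    (honly : ∀ w ∈ s, w ≤ u + Finsupp.single q 1 → w = u) :
    ¬ HasLinearResolution (monomialIdeal K s) := by
  rintro ⟨_, b, ε, φ, -, hφ, hrange, hex, -⟩
  set g : Fin (b 0) → MvPolynomial (Fin n) K := fun k => ε (Pi.single k 1) with hg
  have hε : ∀ f, ε f = ∑ k, f k * g k := fun f => by
    rw [apply_eq_sum_single ε f]
    simp only [smul_eq_mul, hg]
  have hgs : ∀ k w, (g k).coeff w ≠ 0 → ∃ x ∈ s, x ≤ w := fun k w hw =>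
    mem_monomialIdeal.1 (hrange ▸ LinearMap.mem_range_self ε _ : g k ∈ monomialIdeal K s) w
      (MvPolynomial.mem_support_iff.2 hw)
  -- the coefficient of `x^u` in the expansion of an element of the free module
  set π : (Fin (b 0) → MvPolynomial (Fin n) K) →ₗ[MvPolynomial (Fin n) K] MvPolynomial (Fin n) K :=
    Fintype.linearCombination (MvPolynomial (Fin n) K)
      (fun k => MvPolynomial.C ((g k).coeff u)) with hπ
  have hπ_apply : ∀ f, π f = ∑ k, f k * MvPolynomial.C ((g k).coeff u) := fun f => by
    rw [hπ, Fintype.linearCombination_apply]; rfl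
  have hπ_coeff : ∀ f e, (π f).coeff e = ∑ k, (f k).coeff e * (g k).coeff u := fun f e => by
    rw [hπ_apply, MvPolynomial.coeff_sum]
    exact Finset.sum_congr rfl fun k _ => by
      rw [mul_comm, MvPolynomial.coeff_C_mul, mul_comm]
  obtain ⟨f₁, hf₁⟩ : MvPolynomial.monomial u (1 : K) ∈ LinearMap.range ε :=
    hrange ▸ monomial_mem_monomialIdeal.2 ⟨u, hu, le_rfl⟩
  obtain ⟨f₂, hf₂⟩ : MvPolynomial.monomial v (1 : K) ∈ LinearMap.range ε :=
    hrange ▸ monomial_mem_monomialIdeal.2 ⟨v, hv, le_rfl⟩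
  have h1 : (π f₁).coeff 0 = 1 := by
    have h2 := congrArg (MvPolynomial.coeff (0 + u)) hf₁
    rw [hε, MvPolynomial.coeff_sum, zero_add, MvPolynomial.coeff_monomial, if_pos rfl] at h2
    rw [hπ_coeff, ← h2]
    refine Finset.sum_congr rfl fun k _ => ?_
    rw [← coeff_add_mul_of_forall, zero_add]
    intro e' w hw _ hgw
    obtain ⟨x, hx, hxw⟩ := hgs k w hgw
    have hwu : w ≤ u := by rw [zero_add] at hw; exact hw ▸ le_add_self
    have hxu := eq_of_le_of_degree_eq (hxw.trans hwu) ((hs x hx).trans (hs u hu).symm)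
    exact le_antisymm hwu (hxu ▸ hxw)
  have h2 : ∀ l, (π (φ 0 (Pi.single l 1))).coeff (Finsupp.single q 1) = 0 := by
    intro l
    set z := φ 0 (Pi.single l 1) with hz
    have hker : ε z = 0 := (hex z).2 ⟨_, rfl⟩
    have h3 := congrArg (MvPolynomial.coeff (Finsupp.single q 1 + u)) hker
    rw [hε, MvPolynomial.coeff_sum, MvPolynomial.coeff_zero] at h3
    rw [hπ_coeff, ← h3]
    refine Finset.sum_congr rfl fun k _ => ?_
    rw [← coeff_add_mul_of_forall]
    intro e' w hw he' hgw
    obtain ⟨x, hx, hxw⟩ := hgs k w hgw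
    have hdeg : e'.degree = 1 := by
      rw [Finsupp.degree_eq_weight_one]
      exact hφ 0 l k he'
    have hxu := honly x hx (hxw.trans (by rw [add_comm u, ← hw]; exact le_add_self))
    have hdw := congrArg Finsupp.degree hw
    rw [map_add, map_add, hdeg, Finsupp.degree_single] at hdw
    exact (eq_of_le_of_degree_eq (hxu ▸ hxw) (by omega)).symm
  have h4 : ∀ y, (π (φ 0 y)).coeff (Finsupp.single q 1 + Finsupp.single q 1) = 0 := by
    intro y
    rw [apply_eq_sum_single (φ 0) y, map_sum, MvPolynomial.coeff_sum]
    refine Finset.sum_eq_zero fun l _ => ?_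
    rw [map_smul, smul_eq_mul, coeff_add_mul_of_forall, h2, mul_zero]
    intro e' w hw _ hcw
    refine eq_single_of_add_eq ?_ hw
    rw [hπ_coeff] at hcw
    obtain ⟨k, _, hk⟩ := Finset.exists_ne_zero_of_sum_ne_zero hcw
    rw [Finsupp.degree_eq_weight_one]
    exact hφ 0 l k (left_ne_zero_of_mul hk)
  obtain ⟨y, hy⟩ := (hex (MvPolynomial.monomial (Finsupp.single q 2) (1 : K) • f₁ -
    MvPolynomial.monomial (Finsupp.single p 2) (1 : K) • f₂)).1 (by
      rw [map_sub, map_smul, map_smul, hf₁, hf₂, smul_eq_mul, smul_eq_mul,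
        MvPolynomial.monomial_mul, MvPolynomial.monomial_mul, add_comm _ u, add_comm _ v, huv,
        sub_self])
  have h5 := h4 y
  rw [hy, map_sub, map_smul, map_smul, smul_eq_mul, smul_eq_mul, MvPolynomial.coeff_sub,
    ← Finsupp.single_add, MvPolynomial.coeff_monomial_mul', MvPolynomial.coeff_monomial_mul',
    if_pos le_rfl, if_neg, one_add_one_eq_two, tsub_self, h1] at h5
  · simp at h5
  · intro h6
    have := h6 p
    rw [Finsupp.single_eq_same, Finsupp.single_eq_of_ne hpq] at this
    omega

end Ideals

/-! ### Replacing variables by several variables -/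

section Expansion

variable {K : Type*} [Field K] {n : ℕ} {σ : Type*} [DecidableEq σ]

/-- The exponent vector obtained by substituting the variable `r : σ` for all `x_i` with
`ρ i = some r`. The variables with `ρ i = none` are ignored. -/
def collapse (ρ : Fin n → Option σ) (w : Fin n →₀ ℕ) (r : σ) : ℕ :=
  ∑ i with ρ i = some r, w i

/-- The exponent vectors that have exponent `m` at all `i` with `ρ i = none` and collapse to a
member of `L`. -/
def expansion (ρ : Fin n → Option σ) (m : ℕ) (L : Set (σ → ℕ)) : Set (Fin n →₀ ℕ) :=
  {w | (∀ i, ρ i = none → w i = m) ∧ collapse ρ w ∈ L}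

variable {ρ : Fin n → Option σ}

theorem collapse_add (w w' : Fin n →₀ ℕ) :
    collapse ρ (w + w') = collapse ρ w + collapse ρ w' := by
  funext r
  simp [collapse, Finset.sum_add_distrib]

theorem collapse_single {i : Fin n} {s : σ} (h : ρ i = some s) (c : ℕ) (r : σ) :
    collapse ρ (Finsupp.single i c) r = if r = s then c else 0 := by
  simp only [collapse, Finsupp.single_apply]
  rw [Finset.sum_ite_eq]
  simp [h, eq_comm]

theorem le_collapse {w : Fin n →₀ ℕ} {i : Fin n} {r : σ} (h : ρ i = some r) :
    w i ≤ collapse ρ w r :=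
  Finset.single_le_sum (f := fun i => w i) (fun _ _ => Nat.zero_le _) (by simp [h])

theorem exists_le_of_le_sum {ι : Type*} [DecidableEq ι] (s : Finset ι) (x : ι → ℕ) (c : ℕ)
    (h : c ≤ ∑ i ∈ s, x i) : ∃ y : ι → ℕ, (∀ i, y i ≤ x i) ∧ ∑ i ∈ s, y i = c := by
  induction s using Finset.induction_on generalizing c with
  | empty => exact ⟨0, fun _ => Nat.zero_le _, by simpa using (Nat.le_zero.1 h).symm⟩
  | insert a s ha ih =>
    rw [Finset.sum_insert ha] at h
    obtain ⟨y, hy, hyc⟩ := ih (c - min c (x a)) (by omega)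
    refine ⟨Function.update y a (min c (x a)), fun i => ?_, ?_⟩
    · by_cases hi : i = a
      · subst hi; simp
      · simpa [hi] using hy i
    · rw [Finset.sum_insert ha, Function.update_self, Finset.sum_update_of_notMem ha, hyc]
      omega

/-- A divisor of a given monomial with prescribed collapse. -/
theorem exists_le_mem_expansion {m : ℕ} {L : Set (σ → ℕ)} {c : σ → ℕ} (hc : c ∈ L)
    (x : Fin n →₀ ℕ) (hx : c ≤ collapse ρ x) (hm : ∀ i, ρ i = none → m ≤ x i) :
    ∃ w ∈ expansion ρ m L, w ≤ x ∧ collapse ρ w = c := by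
  have hex := fun r => exists_le_of_le_sum (Finset.univ.filter fun i => ρ i = some r) x (c r) (hx r)
  choose y hy hyc using hex
  set w : Fin n →₀ ℕ := Finsupp.equivFunOnFinite.symm
    fun i => (ρ i).elim m fun r => y r i with hw
  have hwi : ∀ i, w i = (ρ i).elim m fun r => y r i := fun i => rfl
  have hcol : collapse ρ w = c := by
    funext r
    rw [← hyc r, collapse]
    refine Finset.sum_congr rfl fun i hi => ?_
    rw [hwi, (Finset.mem_filter.1 hi).2]
    rfl
  refine ⟨w, ⟨fun i hi => by rw [hwi, hi]; rfl, hcol ▸ hc⟩, fun i => ?_, hcol⟩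
  rw [hwi]
  cases h : ρ i with
  | none => exact hm i h
  | some r => exact hy r i

theorem degree_of_mem_expansion [Fintype σ] {m D : ℕ} {L : Set (σ → ℕ)} (hL : ∀ c ∈ L, ∑ r, c r = D)
    {w : Fin n →₀ ℕ} (hw : w ∈ expansion ρ m L) :
    w.degree = (Finset.univ.filter fun i => ρ i = none).card * m + D := by
  rw [Finsupp.degree_eq_sum, ← Finset.sum_fiberwise Finset.univ ρ, Fintype.sum_option,
    ← hL _ hw.2]
  congr 1
  rw [Finset.sum_congr rfl fun i hi => hw.1 i (Finset.mem_filter.1 hi).2, Finset.sum_const,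
    smul_eq_mul]

theorem finite_of_forall_degree_eq {s : Set (Fin n →₀ ℕ)} {D : ℕ} (h : ∀ u ∈ s, u.degree = D) :
    s.Finite :=
  (Set.finite_Iic (Finsupp.equivFunOnFinite.symm fun _ => D)).subset fun u hu i => by
    rw [← h u hu]
    exact Finsupp.le_degree i u

/-- The order on exponent vectors that gives linear quotients: first by a given rank of the
collapse, then lexicographically. -/
def expansionKey (ρ : Fin n → Option σ) (rank : (σ → ℕ) → ℕ) (w : Fin n →₀ ℕ) :
    ℕ ×ₗ Lex (Fin n →₀ ℕ) :=
  toLex (rank (collapse ρ w), toLex w)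

theorem expansionKey_injective (rank : (σ → ℕ) → ℕ) :
    Function.Injective (expansionKey ρ rank) := fun u v h => by
  have := congrArg (fun z => ofLex (ofLex z).2) h
  exact this

theorem expansionKey_lt_of_rank_lt {rank : (σ → ℕ) → ℕ} {u v : Fin n →₀ ℕ}
    (h : rank (collapse ρ v) < rank (collapse ρ u)) :
    expansionKey ρ rank v < expansionKey ρ rank u :=
  Prod.Lex.toLex_lt_toLex.2 (Or.inl h)

/-- Expansion preserves linear quotients: a generator that precedes `u` and has another collapse
is handled by a variable coming from the collapsed ideal; one with the same collapse by moving a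
factor to a later variable of the same fibre. -/
theorem exists_mem_linVars_expansion {rank : (σ → ℕ) → ℕ} {L : Set (σ → ℕ)} {m : ℕ}
    (hinj : Set.InjOn rank L) {u v : Fin n →₀ ℕ} (hu : u ∈ expansion ρ m L)
    (hv : v ∈ earlier (expansionKey ρ rank) (expansion ρ m L) u)
    (h : rank (collapse ρ v) < rank (collapse ρ u) → ∃ t, collapse ρ u t < collapse ρ v t ∧
      ∃ c ∈ L, rank c < rank (collapse ρ u) ∧
        ∀ s, c s ≤ collapse ρ u s + if s = t then 1 else 0) :
    ∃ t ∈ linVars (earlier (expansionKey ρ rank) (expansion ρ m L) u) u, u t < v t := by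
  obtain ⟨hv, hlt⟩ := hv
  rcases Prod.Lex.toLex_lt_toLex.1 hlt with hlt | ⟨heq, hlt⟩
  · obtain ⟨t, ht, c, hc, hcu, hct⟩ := h hlt
    obtain ⟨i, hi, hit⟩ := Finset.exists_lt_of_sum_lt ht
    have hρ : ρ i = some t := (Finset.mem_filter.1 hi).2
    obtain ⟨w, hw, hwu, hwc⟩ := exists_le_mem_expansion (m := m) hc (u + Finsupp.single i 1)
      (fun s => by rw [collapse_add, Pi.add_apply, collapse_single hρ]; exact hct s)
      (fun j hj => by rw [← hu.1 j hj]; exact (le_self_add : u ≤ u + Finsupp.single i 1) j)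
    exact ⟨i, ⟨w, ⟨hw, expansionKey_lt_of_rank_lt (hwc ▸ hcu)⟩, hwu⟩, hit⟩
  · have hcol : collapse ρ v = collapse ρ u := hinj hv.2 hu.2 heq
    obtain ⟨i, hi, hlti⟩ := Finsupp.Lex.lt_iff.1 hlt
    simp only [ofLex_toLex] at hi hlti
    obtain ⟨r, hr⟩ : ∃ r, ρ i = some r := by
      cases hρ : ρ i with
      | none => exact absurd hlti (by rw [hv.1 i hρ, hu.1 i hρ]; exact lt_irrefl _)
      | some r => exact ⟨r, rfl⟩
    obtain ⟨j, hj, hjlt⟩ : ∃ j, ρ j = some r ∧ u j < v j := by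
      by_contra hno
      push Not at hno
      refine absurd (congrFun hcol r) (ne_of_lt ?_)
      exact Finset.sum_lt_sum (fun j hj => hno j (Finset.mem_filter.1 hj).2)
        ⟨i, by simp [hr], hlti⟩
    have hij : i < j := by
      rcases lt_trichotomy i j with h1 | h1 | h1
      · exact h1
      · subst h1; omega
      · have := hi j h1; omega
    have hle : Finsupp.single i 1 ≤ u + Finsupp.single j 1 := by
      rw [Finsupp.single_le_iff, Finsupp.add_apply]
      omega
    obtain ⟨w, hw⟩ := exists_add_of_le hle
    have hwcol : collapse ρ w = collapse ρ u := by
      have h1 := congrArg (collapse ρ) hw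
      rw [collapse_add, collapse_add] at h1
      funext s
      have h2 := congrFun h1 s
      rw [Pi.add_apply, Pi.add_apply, collapse_single hj, collapse_single hr] at h2
      omega
    have hwapp : ∀ l, u l + (if j = l then 1 else 0) = (if i = l then 1 else 0) + w l := fun l => by
      have h1 := DFunLike.congr_fun hw l
      rwa [Finsupp.add_apply, Finsupp.add_apply, Finsupp.single_apply, Finsupp.single_apply] at h1
    refine ⟨j, ⟨w, ⟨⟨fun l hl => ?_, hwcol ▸ hu.2⟩, ?_⟩, hw ▸ le_add_self⟩, hjlt⟩
    · have h1 := hwapp l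
      rw [if_neg (fun h => by rw [← h, hj] at hl; exact absurd hl (Option.some_ne_none _)),
        if_neg (fun h => by rw [← h, hr] at hl; exact absurd hl (Option.some_ne_none _))] at h1
      rw [← hu.1 l hl]
      omega
    · refine Prod.Lex.toLex_lt_toLex.2 (Or.inr ⟨congrArg rank hwcol, ?_⟩)
      refine Finsupp.Lex.lt_iff.2 ⟨i, fun l hl => ?_, ?_⟩
      · have h1 := hwapp l
        rw [if_neg (hl.trans hij).ne', if_neg hl.ne'] at h1
        simp only [ofLex_toLex]
        omega
      · have h1 := hwapp i
        rw [if_neg hij.ne', if_pos rfl] at h1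
        simp only [ofLex_toLex]
        omega

/-- The square of an expanded monomial ideal is the expansion of the square. -/
theorem monomialIdeal_expansion_sq (L L' : Set (σ → ℕ))
    (hL : ∀ c, c ∈ L' ↔ ∃ a ∈ L, ∃ b ∈ L, a + b = c) :
    monomialIdeal K (expansion ρ 1 L) ^ 2 = monomialIdeal K (expansion ρ 2 L') := by
  rw [sq, monomialIdeal, monomialIdeal, Ideal.span_mul_span']
  congr 1
  ext p
  simp only [Set.mem_mul, Set.mem_image]
  constructor
  · rintro ⟨_, ⟨u, hu, rfl⟩, _, ⟨v, hv, rfl⟩, rfl⟩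
    refine ⟨u + v, ⟨fun i hi => ?_, ?_⟩, by rw [MvPolynomial.monomial_mul, one_mul]⟩
    · rw [Finsupp.add_apply, hu.1 i hi, hv.1 i hi]
    · rw [collapse_add]
      exact (hL _).2 ⟨_, hu.2, _, hv.2, rfl⟩
  · rintro ⟨w, hw, rfl⟩
    obtain ⟨a, ha, b, hb, hab⟩ := (hL _).1 hw.2
    obtain ⟨u, hu, huw, hua⟩ := exists_le_mem_expansion (m := 1) ha w (hab ▸ le_self_add)
      (fun i hi => by rw [hw.1 i hi]; exact one_le_two)
    obtain ⟨v, rfl⟩ := exists_add_of_le huw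
    refine ⟨_, ⟨u, hu, rfl⟩, _, ⟨v, ⟨fun i hi => ?_, ?_⟩, rfl⟩,
      by rw [MvPolynomial.monomial_mul, one_mul]⟩
    · have := hw.1 i hi
      rw [Finsupp.add_apply, hu.1 i hi] at this
      omega
    · rw [collapse_add, hua] at hab
      rwa [← add_left_cancel hab]

end Expansion

/-! ### An ideal in six variables -/

section SixVariables

/-- The exponents of Sturmfels's ideal `(bcd, acd, abd, abc, cde, abe, adf, bcf)`, the variables
`a, …, f` having the indices `0, …, 5`. -/
def sixGens : List (Fin 6 → ℕ) :=
  [![0, 1, 1, 1, 0, 0], ![1, 0, 1, 1, 0, 0], ![1, 1, 0, 1, 0, 0], ![1, 1, 1, 0, 0, 0],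
   ![0, 0, 1, 1, 1, 0], ![1, 1, 0, 0, 1, 0], ![1, 0, 0, 1, 0, 1], ![0, 1, 1, 0, 0, 1]]

/-- The exponents of the generators of the square of the ideal of `sixGens`. -/
def sixSqGens : List (Fin 6 → ℕ) :=
  (sixGens.flatMap fun u => sixGens.map fun v => u + v).dedup

/-- A rank whose order on exponents at most `2` is lexicographic, the last variable being the most
significant. -/
def sixRank (c : Fin 6 → ℕ) : ℕ :=
  ∑ r, c r * 3 ^ (r : ℕ)

theorem mem_sixSqGens (c : Fin 6 → ℕ) :
    c ∈ sixSqGens ↔ ∃ a ∈ sixGens, ∃ b ∈ sixGens, a + b = c := by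
  simp [sixSqGens]

theorem sum_of_mem_sixGens : ∀ c ∈ sixGens, ∑ r, c r = 3 := by decide +kernel

theorem le_one_of_mem_sixGens : ∀ c ∈ sixGens, ∀ r, c r ≤ 1 := by decide +kernel

theorem exists_mem_sixGens_ne_zero : ∀ r, ∃ c ∈ sixGens, c r ≠ 0 := by decide +kernel

theorem sum_of_mem_sixSqGens : ∀ c ∈ sixSqGens, ∑ r, c r = 6 := by decide +kernel

theorem sixRank_injOn_sixGens : ∀ c ∈ sixGens, ∀ c' ∈ sixGens, sixRank c = sixRank c' → c = c' := by
  decide +kernel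

theorem sixRank_injOn_sixSqGens :
    ∀ c ∈ sixSqGens, ∀ c' ∈ sixSqGens, sixRank c = sixRank c' → c = c' := by
  decide +kernel

theorem linearQuotients_sixGens : ∀ c ∈ sixGens, ∀ c' ∈ sixGens, sixRank c' < sixRank c →
    ∃ t, c t < c' t ∧ ∃ a ∈ sixGens, sixRank a < sixRank c ∧
      ∀ s, a s ≤ c s + if s = t then 1 else 0 := by
  decide +kernel

/-- The square has linear quotients except for the colon ideal of `abcdf²`, which also contains
`e²` because of the generator `abcde²`. -/
theorem linearQuotients_sixSqGens : ∀ c ∈ sixSqGens, ∀ c' ∈ sixSqGens, sixRank c' < sixRank c →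
    (c = ![1, 1, 1, 1, 0, 2] ∧ c' = ![1, 1, 1, 1, 2, 0]) ∨
    ∃ t, c t < c' t ∧ ∃ a ∈ sixSqGens, sixRank a < sixRank c ∧
      ∀ s, a s ≤ c s + if s = t then 1 else 0 := by
  decide +kernel

theorem exists_two_le_of_mem_sixSqGens : ∀ c ∈ sixSqGens, ∃ r, 2 ≤ c r := by decide +kernel

theorem exists_mem_sixSqGens_le : ∀ r, ∃ c ∈ sixSqGens, ∀ s, c s ≤ 1 + if s = r then 1 else 0 := by
  decide +kernel

theorem eq_of_le_of_mem_sixSqGens : ∀ c ∈ sixSqGens,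
    (∀ s, c s ≤ (![1, 1, 1, 1, 0, 2] : Fin 6 → ℕ) s + if s = 4 then 1 else 0) →
    c = ![1, 1, 1, 1, 0, 2] := by
  decide +kernel

end SixVariables

/-! ### The ideal in `n` variables -/

section Construction

variable {K : Type*} [Field K] {n k : ℕ}

/-- The indices `0, …, 5` are the six variables, the next `k` are factors common to all generators,
and the remaining ones are copies of the variable `0`. -/
def role (n k : ℕ) (i : Fin n) : Option (Fin 6) :=
  if h : (i : ℕ) < 6 then some ⟨i, h⟩ else if (i : ℕ) < 6 + k then none else some 0

theorem role_eq_none {i : Fin n} : role n k i = none ↔ 6 ≤ (i : ℕ) ∧ (i : ℕ) < 6 + k := by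
  unfold role
  split_ifs <;> simp <;> omega

/-- The variable `r` among the first six. -/
def vertex (hn : 6 + k ≤ n) (r : Fin 6) : Fin n :=
  ⟨r, by omega⟩

theorem role_vertex (hn : 6 + k ≤ n) (r : Fin 6) : role n k (vertex hn r) = some r := by
  simp [role, vertex]

theorem eq_vertex_or_le (hn : 6 + k ≤ n) {i : Fin n} {r : Fin 6} (h : role n k i = some r) :
    i = vertex hn r ∨ (6 + k ≤ (i : ℕ) ∧ r = 0) := by
  unfold role at h
  split_ifs at h with h1 h2
  · left
    rw [← Option.some.inj h]
    rfl
  · exact Or.inr ⟨by omega, (Option.some.inj h).symm⟩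

theorem card_role_eq_none (hn : 6 + k ≤ n) :
    (Finset.univ.filter fun i => role n k i = none).card = k := by
  have h : (Finset.univ.filter fun i => role n k i = none).map Fin.valEmbedding =
      Finset.Ico 6 (6 + k) := by
    ext j
    simp only [Finset.mem_map, Finset.mem_filter, Finset.mem_univ, true_and, role_eq_none,
      Fin.valEmbedding_apply, Finset.mem_Ico]
    exact ⟨fun ⟨i, hi, hij⟩ => hij ▸ hi, fun hj => ⟨⟨j, by omega⟩, hj, rfl⟩⟩
  rw [← Finset.card_map, h, Nat.card_Ico]
  omega

/-- The exponent vectors of the generators of the ideal. -/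
abbrev gens (n k : ℕ) : Set (Fin n →₀ ℕ) :=
  expansion (role n k) 1 {c | c ∈ sixGens}

/-- The exponent vectors of the generators of the square of the ideal. -/
abbrev sqGens (n k : ℕ) : Set (Fin n →₀ ℕ) :=
  expansion (role n k) 2 {c | c ∈ sixSqGens}

theorem degree_of_mem_gens (hn : 6 + k ≤ n) : ∀ w ∈ gens n k, w.degree = k + 3 := fun w hw => by
  rw [degree_of_mem_expansion sum_of_mem_sixGens hw, card_role_eq_none hn, mul_one]

theorem degree_of_mem_sqGens (hn : 6 + k ≤ n) : ∀ w ∈ sqGens n k, w.degree = k * 2 + 6 :=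
  fun w hw => by
    rw [degree_of_mem_expansion sum_of_mem_sixSqGens hw, card_role_eq_none hn]

theorem monomialIdeal_gens_sq : monomialIdeal K (gens n k) ^ 2 = monomialIdeal K (sqGens n k) :=
  monomialIdeal_expansion_sq _ _ mem_sixSqGens

/-- The exponent vector that is `c` on the six variables, `2` on the common factors and `0` on the
copies of the variable `0`. -/
def stdSqExponent (n k : ℕ) (c : Fin 6 → ℕ) : Fin n →₀ ℕ :=
  Finsupp.equivFunOnFinite.symm fun i =>
    if h : (i : ℕ) < 6 then c ⟨i, h⟩ else if (i : ℕ) < 6 + k then 2 else 0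

theorem stdSqExponent_apply (c : Fin 6 → ℕ) (i : Fin n) : stdSqExponent n k c i =
    if h : (i : ℕ) < 6 then c ⟨i, h⟩ else if (i : ℕ) < 6 + k then 2 else 0 := rfl

/-- The collapse of an exponent vector that vanishes on the copies of the variable `0`. -/
theorem collapse_eq_of_forall_eq_zero (hn : 6 + k ≤ n) {w : Fin n →₀ ℕ}
    (hw : ∀ i : Fin n, 6 + k ≤ (i : ℕ) → w i = 0) (r : Fin 6) :
    collapse (role n k) w r = w (vertex hn r) := by
  refine Finset.sum_eq_single_of_mem _ (by simp [role_vertex]) fun i hi hne => ?_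
  rcases eq_vertex_or_le hn (Finset.mem_filter.1 hi).2 with h | h
  · exact absurd h hne
  · exact hw i h.1

theorem collapse_stdSqExponent (hn : 6 + k ≤ n) (c : Fin 6 → ℕ) :
    collapse (role n k) (stdSqExponent n k c) = c := by
  funext r
  rw [collapse_eq_of_forall_eq_zero hn]
  · simp [stdSqExponent_apply, vertex]
  · intro i hi
    rw [stdSqExponent_apply, dif_neg (by omega), if_neg (by omega)]

theorem stdSqExponent_mem (hn : 6 + k ≤ n) {c : Fin 6 → ℕ} (hc : c ∈ sixSqGens) :
    stdSqExponent n k c ∈ sqGens n k := by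
  refine ⟨fun i hi => ?_, ?_⟩
  · rw [role_eq_none] at hi
    rw [stdSqExponent_apply, dif_neg (by omega), if_pos hi.2]
  · rw [collapse_stdSqExponent hn]
    exact hc

theorem hasLinearQuotients_gens (hn : 6 + k ≤ n) :
    HasLinearQuotients (monomialIdeal K (gens n k)) := by
  obtain ⟨G, hG⟩ := (finite_of_forall_degree_eq (degree_of_mem_gens hn)).exists_finset_coe
  have hmem : ∀ u, u ∈ G ↔ u ∈ gens n k := fun u => by rw [← hG, Finset.mem_coe]
  rw [← hG]
  refine hasLinearQuotients_monomialIdeal (expansionKey (role n k) sixRank)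
    (expansionKey_injective _) (k + 3) G
    (fun u hu => degree_of_mem_gens hn u ((hmem u).1 hu)) fun u hu v hv => ?_
  rw [hmem] at hu
  rw [hG] at hv ⊢
  exact exists_mem_linVars_expansion (fun a ha b hb => sixRank_injOn_sixGens a ha b hb) hu hv
    (linearQuotients_sixGens _ hu.2 _ hv.1.2)

theorem not_nontrivial_localCohomology_sq (hn : 6 + k ≤ n) {i j : ℤ}
    (hij : 2 * (k : ℤ) + 7 < i + j) :
    ¬ Nontrivial (LocalCohomology (monomialIdeal K (sqGens n k)) i j) := by
  refine not_nontrivial_localCohomology _ i j fun α hα => ?_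
  obtain ⟨G, hG⟩ := (finite_of_forall_degree_eq (degree_of_mem_sqGens hn)).exists_finset_coe
  have hmem : ∀ u, u ∈ G ↔ u ∈ sqGens n k := fun u => by rw [← hG, Finset.mem_coe]
  rw [← hG]
  refine acyclicAt_upset (expansionKey (role n k) sixRank) (expansionKey_injective _)
    (vertex hn 4) (k * 2 + 6) G (fun u hu => degree_of_mem_sqGens hn u ((hmem u).1 hu)) ?_ α i
    (by push_cast; omega)
  intro u hu v hv
  rw [hmem] at hu
  rw [hG] at hv ⊢
  by_cases hexc : collapse (role n k) u = ![1, 1, 1, 1, 0, 2] ∧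
      collapse (role n k) v = ![1, 1, 1, 1, 2, 0]
  · right
    have hval : ∀ w : Fin n →₀ ℕ, collapse (role n k) w 4 = w (vertex hn 4) := by
      intro w
      refine Finset.sum_eq_single_of_mem _ (by simp [role_vertex]) fun i hi hne => ?_
      rcases eq_vertex_or_le hn (Finset.mem_filter.1 hi).2 with h | h
      · exact absurd h hne
      · exact absurd h.2 (by decide)
    constructor
    · obtain ⟨w, hw, hwu, hwc⟩ := exists_le_mem_expansion (ρ := role n k) (m := 2) hv.1.2
        (u + Finsupp.single (vertex hn 4) 2)
        (fun s => by
          rw [collapse_add, Pi.add_apply, collapse_single (role_vertex hn 4), hexc.1, hexc.2]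
          revert s
          decide)
        (fun i hi => by
          refine (hu.1 i hi).ge.trans ?_
          exact (le_self_add : u ≤ u + Finsupp.single (vertex hn 4) 2) i)
      refine ⟨w, ⟨hw, expansionKey_lt_of_rank_lt ?_⟩, hwu⟩
      rw [hwc, hexc.1, hexc.2]
      decide
    · rw [← hval, ← hval, hexc.1, hexc.2]
      decide
  · left
    refine exists_mem_linVars_expansion (fun a ha b hb => sixRank_injOn_sixSqGens a ha b hb) hu hv
      fun hlt => ?_
    exact (linearQuotients_sixSqGens _ hu.2 _ hv.1.2 hlt).resolve_left hexc

/-- The multidegree with exponent `1` on the six variables and the common factors and `0` on the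
copies of the variable `0`. -/
def topDegree (n k : ℕ) : Fin n →₀ ℕ :=
  Finsupp.equivFunOnFinite.symm fun i => if (i : ℕ) < 6 + k then 1 else 0

theorem topDegree_apply (i : Fin n) : topDegree n k i = if (i : ℕ) < 6 + k then 1 else 0 := rfl

theorem collapse_topDegree (hn : 6 + k ≤ n) (r : Fin 6) :
    collapse (role n k) (topDegree n k) r = 1 := by
  rw [collapse_eq_of_forall_eq_zero hn]
  · rw [topDegree_apply, if_pos]
    simp only [vertex]
    omega
  · intro i hi
    rw [topDegree_apply, if_neg (by omega)]

theorem sum_topDegree (hn : 6 + k ≤ n) : ∑ i, topDegree n k i = 6 + k := by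
  simp only [topDegree_apply]
  rw [Finset.sum_boole, Fin.card_filter_val_lt]
  simp [hn]

/-- Every generator of the square has an exponent `2` outside the common factors, so `x_Z` alone
cannot clear the denominators; but any further variable is squared in a suitable generator. -/
theorem mem_upset_topDegree (hn : 6 + k ≤ n) (A : Finset (Fin n)) :
    A ∈ upset (sqGens n k) (fun i => (topDegree n k i : ℤ)) ↔
      (Finset.univ.filter fun i => role n k i = none) ⊂ A := by
  constructor
  · rintro ⟨w, hw, hwA⟩
    have hsub : (Finset.univ.filter fun i => role n k i = none) ⊆ A := by
      intro i hi
      have hi' := (Finset.mem_filter.1 hi).2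
      by_contra hA
      have h1 : w i ≤ topDegree n k i := Int.ofNat_le.1 (hwA i hA)
      rw [hw.1 i hi', topDegree_apply] at h1
      split_ifs at h1 <;> omega
    refine hsub.ssubset_of_ne ?_
    rintro rfl
    obtain ⟨r, hr⟩ := exists_two_le_of_mem_sixSqGens _ hw.2
    have hle : collapse (role n k) w r ≤ collapse (role n k) (topDegree n k) r := by
      refine Finset.sum_le_sum fun i hi => ?_
      have : (w i : ℤ) ≤ topDegree n k i := hwA i (by simp [(Finset.mem_filter.1 hi).2])
      exact_mod_cast this
    rw [collapse_topDegree hn] at hle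
    omega
  · intro hA
    obtain ⟨x, hxA, hx⟩ := Finset.exists_of_ssubset hA
    obtain ⟨r, hr⟩ : ∃ r, role n k x = some r :=
      Option.ne_none_iff_exists'.1 fun h => hx (by simp [h])
    obtain ⟨c, hc, hcr⟩ := exists_mem_sixSqGens_le r
    set y : Fin n →₀ ℕ := Finsupp.equivFunOnFinite.symm fun i =>
      if role n k i = none then 1 else 0 with hy
    have hyi : ∀ i, y i = if role n k i = none then 1 else 0 := fun i => rfl
    obtain ⟨w, hw, hwle, -⟩ := exists_le_mem_expansion (ρ := role n k) (m := 2)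
      (L := {c | c ∈ sixSqGens}) hc (topDegree n k + Finsupp.single x 1 + y)
      (fun s => by
        rw [collapse_add, collapse_add, Pi.add_apply, Pi.add_apply, collapse_topDegree hn,
          collapse_single hr]
        exact (hcr s).trans (Nat.le_add_right _ _))
      (fun i hi => by
        have := role_eq_none.1 hi
        rw [Finsupp.add_apply, Finsupp.add_apply, hyi, if_pos hi, topDegree_apply, if_pos this.2]
        omega)
    refine ⟨w, hw, fun i hi => ?_⟩
    have h1 := hwle i
    rw [Finsupp.add_apply, Finsupp.add_apply, hyi, Finsupp.single_apply,
      if_neg (fun h : x = i => hi (h ▸ hxA)),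
      if_neg (fun h => hi (hA.1 (Finset.mem_filter.2 ⟨Finset.mem_univ i, h⟩)))] at h1
    exact Int.ofNat_le.2 h1

theorem hasRegularity_sq (hn : 6 + k ≤ n) :
    HasRegularity (monomialIdeal K (sqGens n k)) (2 * (k : ℤ) + 7) := by
  constructor
  · refine ⟨_, _, nontrivial_localCohomology _ _ _ (mem_upset_topDegree hn) (vertex hn 0)
      (by simp [role_vertex]), ?_⟩
    have h := congrArg (Nat.cast : ℕ → ℤ) (sum_topDegree hn)
    push_cast at h
    rw [h, card_role_eq_none hn]
    ring
  · rintro _ ⟨i, j, hij, rfl⟩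
    by_contra hlt
    exact not_nontrivial_localCohomology_sq hn (not_le.1 hlt) hij

theorem not_hasLinearResolution_sq (hn : 6 + k ≤ n) :
    ¬ HasLinearResolution (monomialIdeal K (sqGens n k)) := by
  have hu : (![1, 1, 1, 1, 0, 2] : Fin 6 → ℕ) ∈ sixSqGens := by decide +kernel
  have hv : (![1, 1, 1, 1, 2, 0] : Fin 6 → ℕ) ∈ sixSqGens := by decide +kernel
  refine not_hasLinearResolution_monomialIdeal _ _ (degree_of_mem_sqGens hn)
    (stdSqExponent_mem hn hu) (stdSqExponent_mem hn hv) (p := vertex hn 5) (q := vertex hn 4)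
    (by simp [vertex, Fin.ext_iff]) ?_ fun w hw hle => ?_
  · ext i
    simp only [Finsupp.add_apply, stdSqExponent_apply, Finsupp.single_apply, vertex, Fin.ext_iff]
    by_cases hi : (i : ℕ) < 6
    · simp only [hi, dif_pos]
      obtain ⟨i, hin⟩ := i
      simp only at hi ⊢
      interval_cases i <;> rfl
    · simp only [hi, dif_neg, not_false_iff]
      split_ifs <;> simp at * <;> omega
  · have hcol : collapse (role n k) w = ![1, 1, 1, 1, 0, 2] := by
      refine eq_of_le_of_mem_sixSqGens _ hw.2 fun s => ?_
      have h1 : collapse (role n k) w s ≤ collapse (role n k)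
          (stdSqExponent n k ![1, 1, 1, 1, 0, 2] + Finsupp.single (vertex hn 4) 1) s :=
        Finset.sum_le_sum fun i _ => hle i
      rwa [collapse_add, Pi.add_apply, collapse_stdSqExponent hn,
        collapse_single (role_vertex hn 4)] at h1
    have h4 : w (vertex hn 4) = 0 := by
      have := le_collapse (w := w) (role_vertex hn 4)
      rw [hcol] at this
      exact Nat.le_zero.1 this
    refine eq_of_le_of_degree_eq (fun i => ?_) ((degree_of_mem_sqGens hn w hw).trans
      (degree_of_mem_sqGens hn _ (stdSqExponent_mem hn hu)).symm)
    by_cases hi : i = vertex hn 4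
    · rw [hi, h4]; exact Nat.zero_le _
    · have := hle i
      rwa [Finsupp.add_apply, Finsupp.single_eq_of_ne hi, add_zero] at this

theorem exists_mem_gens_ne_zero (hn : 6 + k ≤ n) (i : Fin n) : ∃ w ∈ gens n k, w i ≠ 0 := by
  obtain ⟨r, hr⟩ : ∃ r : Fin 6, role n k i = none ∨ role n k i = some r := by
    cases h : role n k i with
    | none => exact ⟨0, Or.inl rfl⟩
    | some r => exact ⟨r, Or.inr rfl⟩
  obtain ⟨c, hc, hcr⟩ := exists_mem_sixGens_ne_zero r
  -- the fibre of `r` is cut down to `i`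
  set x : Fin n →₀ ℕ := Finsupp.equivFunOnFinite.symm fun j =>
    if role n k j = some r ∧ role n k i = some r ∧ j ≠ i then 0 else 1 with hx
  have hxj : ∀ j, x j = if role n k j = some r ∧ role n k i = some r ∧ j ≠ i then 0 else 1 :=
    fun j => rfl
  obtain ⟨w, hw, hwx, hwc⟩ := exists_le_mem_expansion (ρ := role n k) (m := 1)
    (L := {c | c ∈ sixGens}) hc x
    (fun s => by
      refine (le_one_of_mem_sixGens c hc s).trans ?_
      by_cases hs : role n k i = some s
      · refine le_trans ?_ (le_collapse hs)
        rw [hxj, if_neg fun h => h.2.2 rfl]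
      · refine le_trans ?_ (le_collapse (role_vertex hn s))
        rw [hxj, if_neg]
        rintro ⟨h1, h2, -⟩
        rw [role_vertex hn] at h1
        exact hs (h2.trans h1.symm))
    (fun j hj => by rw [hxj, if_neg fun h => by rw [hj] at h; exact absurd h.1 (by simp)])
  refine ⟨w, hw, ?_⟩
  rcases hr with hr | hr
  · rw [hw.1 i hr]; exact one_ne_zero
  · intro h0
    rw [← hwc] at hcr
    obtain ⟨j, hj, hwj⟩ := Finset.exists_ne_zero_of_sum_ne_zero hcr
    have h1 := hwx j
    by_cases hji : j = i
    · exact hwj (hji ▸ h0)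
    · rw [hxj, if_pos ⟨(Finset.mem_filter.1 hj).2, hr, hji⟩] at h1
      omega

theorem le_one_of_mem_gens {w : Fin n →₀ ℕ} (hw : w ∈ gens n k) (i : Fin n) : w i ≤ 1 := by
  cases h : role n k i with
  | none => exact (hw.1 i h).le
  | some r => exact (le_collapse h).trans (le_one_of_mem_sixGens _ hw.2 r)

end Construction

end MonomialIdeals

end

theorem theoremD (K : Type*) [Field K] (n d : ℕ) (hn : 6 ≤ n) (hd : 3 ≤ d) (hdn : d ≤ n - 3) :
    ∃ I : Ideal (MvPolynomial (Fin n) K),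
      MonomialIdeals.IsSquarefreeMonomialIdeal I ∧
      MonomialIdeals.IsFullySupported I ∧
      MonomialIdeals.GeneratedInDegree I d ∧
      MonomialIdeals.HasLinearQuotients I ∧
      MonomialIdeals.HasRegularity (I ^ 2) (2 * (d : ℤ) + 1) ∧
      ¬ MonomialIdeals.HasLinearResolution (I ^ 2) := by
  obtain ⟨k, rfl⟩ := Nat.exists_eq_add_of_le' hd
  have hkn : 6 + k ≤ n := by omega
  have hmin := MonomialIdeals.minGens_monomialIdeal (K := K)
    (MonomialIdeals.degree_of_mem_gens hkn)
  refine ⟨MonomialIdeals.monomialIdeal K (MonomialIdeals.gens n k), ⟨⟨_, rfl⟩, fun u hu i => ?_⟩,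
    Set.eq_univ_of_forall fun i => ?_, fun u hu => ?_,
    MonomialIdeals.hasLinearQuotients_gens hkn, ?_, ?_⟩
  · rw [hmin] at hu
    exact MonomialIdeals.le_one_of_mem_gens hu i
  · obtain ⟨w, hw, hwi⟩ := MonomialIdeals.exists_mem_gens_ne_zero hkn i
    exact Set.mem_biUnion (hmin.symm ▸ hw) hwi
  · rw [hmin] at hu
    exact MonomialIdeals.degree_of_mem_gens hkn u hu
  · rw [MonomialIdeals.monomialIdeal_gens_sq]
    have h := MonomialIdeals.hasRegularity_sq (K := K) hkn
    push_cast
    rwa [show 2 * ((k : ℤ) + 3) + 1 = 2 * (k : ℤ) + 7 by ring]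
  · rw [MonomialIdeals.monomialIdeal_gens_sq]
    exact MonomialIdeals.not_hasLinearResolution_sq hkn
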